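/- Let $d\ge 1$, let $M=(S^1)^d$ be the $d$-torus, let $\widetilde M\to M$ be its universal covering, and let $\Gamma=\pi_1(M)\cong\mathbb Z^d$, acting on $\widetilde M$ as the group of all deck transformations. Let $\alpha=\Gamma\curvearrowright(X,\mu)$ be an essentially free standard $\Gamma$-space, i.e. a standard Borel probability space with a measurable, measure preserving left $\Gamma$-action such that $\mu$-almost every point has trivial stabiliser. Let $L^\infty(X;\mathbb Z)$ be the group of essentially bounded measurable functions $X\to\mathbb Z$ modulo $\mu$-almost everywhere equality, with the right $\Gamma$-action $(f\cdot\gamma)(x)=f(\gamma x)$ and the norm $|f|=\int_X|f|\,d\mu$. Equip the chain complex $$C_*(M;\alpha)=L^\infty(X;\mathbb Z)\otimes_{\mathbb Z\Gamma}C_*(\widetilde M;\mathbb Z),$$ where $C_*(\widetilde M;\mathbb Z)$ is the singular chain complex, with the norm $\bigl|\sum_{j=1}^m f_j\otimes\sigma_j\bigr|_1=\sum_{j=1}^m|f_j|$, where the singular simplices $\sigma_1,\dots,\sigma_m$ of $\widetilde M$ belong to pairwise different $\Gamma$-orbits. Then $C_*(M;\alpha)$ satisfies the uniform boundary condition in every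 degree: for every $n\in\mathbb N$ there is a constant $K>0$ such that for every null-homologous cycle $c\in C_n(M;\alpha)$ there is a chain $b\in C_{n+1}(M;\alpha)$ with $$\partial b=c\qquad\text{and}\qquad |b|_1\le K\cdot|c|_1 .$$ -/

import Mathlib

open MeasureTheory
open scoped ENNReal TensorProduct

noncomputable section

namespace ParamUBC

/-! ### Universal coverings and deck transformations -/

/-- `p : E → M` is a universal covering (a covering map with simply connected total space), and the
action of `Γ` on `E` identifies `Γ` with the group of all deck transformations of `p`, i.e. with
the fundamental group of `M` acting on the universal covering by deck transformations. -/
structure IsUniversalCovering (Γ : Type*) [Group Γ] {E M : Type*} [TopologicalSpace E]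
    [TopologicalSpace M] [MulAction Γ E] [ContinuousConstSMul Γ E] (p : E → M) : Prop where
  isCoveringMap : IsCoveringMap p
  simplyConnectedSpace : SimplyConnectedSpace E
  /-- Every element of `Γ` acts by a deck transformation. -/
  proj_smul : ∀ (γ : Γ) (e : E), p (γ • e) = p e
  /-- Different elements of `Γ` act by different deck transformations. -/
  faithful : ∀ γ : Γ, (∀ e : E, γ • e = e) → γ = 1
  /-- Every deck transformation comes from an element of `Γ`. -/
  exists_smul_eq : ∀ φ : E ≃ₜ E, (∀ e, p (φ e) = p e) → ∃ γ : Γ, ∀ e, φ e = γ • e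

/-! ### Singular chains -/

/-- Singular `n`-simplices of `E`. -/
abbrev Simp (E : Type*) [TopologicalSpace E] (n : ℕ) : Type _ :=
  C(stdSimplex ℝ (Fin (n + 1)), E)

/-- Singular `n`-chains of `E` with integral coefficients. -/
abbrev SingChain (E : Type*) [TopologicalSpace E] (n : ℕ) : Type _ := Simp E n →₀ ℤ

/-- The `i`-th face (omitting the `i`-th vertex) of a singular simplex. -/
def face {E : Type*} [TopologicalSpace E] {n : ℕ} (i : Fin (n + 2)) (σ : Simp E (n + 1)) :
    Simp E n :=
  σ.comp ⟨stdSimplex.map i.succAbove, stdSimplex.continuous_map _⟩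

/-- The singular boundary operator `σ ↦ ∑ i, (-1) ^ i • ∂ᵢ σ`. -/
def singBoundary (E : Type*) [TopologicalSpace E] (n : ℕ) :
    SingChain E (n + 1) →ₗ[ℤ] SingChain E n :=
  Finsupp.linearCombination ℤ fun σ : Simp E (n + 1) =>
    ∑ i : Fin (n + 2), (-1 : ℤ) ^ (i : ℕ) • Finsupp.single (face i σ) (1 : ℤ)

/-- The action of a group element on singular chains: `σ ↦ γ • σ` on simplices. -/
def chainSMul {Γ E : Type*} [Group Γ] [TopologicalSpace E] [MulAction Γ E]
    [ContinuousConstSMul Γ E] (γ : Γ) (n : ℕ) : SingChain E n →ₗ[ℤ] SingChain E n :=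
  Finsupp.lmapDomain ℤ ℤ fun σ : Simp E n => γ • σ

theorem face_smul {Γ E : Type*} [Group Γ] [TopologicalSpace E] [MulAction Γ E]
    [ContinuousConstSMul Γ E] (γ : Γ) {n : ℕ} (i : Fin (n + 2)) (σ : Simp E (n + 1)) :
    face i (γ • σ) = γ • face i σ := rfl

theorem singBoundary_single {E : Type*} [TopologicalSpace E] (n : ℕ) (σ : Simp E (n + 1)) :
    singBoundary E n (Finsupp.single σ 1) =
      ∑ i : Fin (n + 2), (-1 : ℤ) ^ (i : ℕ) • Finsupp.single (face i σ) (1 : ℤ) := by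
  simp [singBoundary]

theorem chainSMul_single {Γ E : Type*} [Group Γ] [TopologicalSpace E] [MulAction Γ E]
    [ContinuousConstSMul Γ E] (γ : Γ) {n : ℕ} (σ : Simp E n) (m : ℤ) :
    chainSMul γ n (Finsupp.single σ m) = Finsupp.single (γ • σ) m := by
  simp [chainSMul]

theorem singBoundary_chainSMul {Γ E : Type*} [Group Γ] [TopologicalSpace E] [MulAction Γ E]
    [ContinuousConstSMul Γ E] (γ : Γ) (n : ℕ) (c : SingChain E (n + 1)) :
    singBoundary E n (chainSMul γ (n + 1) c) = chainSMul γ n (singBoundary E n c) := by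
  have : singBoundary E n ∘ₗ chainSMul γ (n + 1) = chainSMul γ n ∘ₗ singBoundary E n := by
    refine Finsupp.lhom_ext' fun σ => LinearMap.ext_ring ?_
    simp [chainSMul_single, singBoundary_single, face_smul]
  exact LinearMap.congr_fun this c

theorem face_face {E : Type*} [TopologicalSpace E] {n : ℕ} (i : Fin (n + 2)) (j : Fin (n + 3))
    (h : (j : ℕ) ≤ (i : ℕ)) (σ : Simp E (n + 2)) :
    face i (face j σ) = face (Fin.castLT j (h.trans_lt i.is_lt)) (face i.succ σ) := by
  have key : j.succAbove ∘ i.succAbove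
      = i.succ.succAbove ∘ (Fin.castLT j (h.trans_lt i.is_lt)).succAbove := by
    funext k
    ext
    simp only [Function.comp, Fin.succAbove, Fin.lt_def]
    split_ifs <;> simp_all <;> omega
  ext x
  simp only [face, ContinuousMap.comp_apply, ContinuousMap.coe_mk, stdSimplex.map_comp_apply, key]

theorem singBoundary_singBoundary {E : Type*} [TopologicalSpace E] (n : ℕ)
    (c : SingChain E (n + 2)) : singBoundary E n (singBoundary E (n + 1) c) = 0 := by
  have : singBoundary E n ∘ₗ singBoundary E (n + 1) = 0 := by
    refine Finsupp.lhom_ext' fun σ => LinearMap.ext_ring ?_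
    simp only [LinearMap.comp_apply, Finsupp.lsingle_apply, singBoundary_single, map_sum, map_smul,
      LinearMap.zero_apply, Finset.smul_sum, smul_smul]
    rw [Finset.sum_comm]
    simp only [← Finset.sum_product']
    let S : Finset (Fin (n + 2) × Fin (n + 3)) := {ij | (ij.2 : ℕ) ≤ (ij.1 : ℕ)}
    rw [Finset.univ_product_univ, ← Finset.sum_add_sum_compl S, ← eq_neg_iff_add_eq_zero,
      ← Finset.sum_neg_distrib]
    let φ : ∀ ij : Fin (n + 2) × Fin (n + 3), ij ∈ S → Fin (n + 2) × Fin (n + 3) := fun ij hij =>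
      (Fin.castLT ij.2 (lt_of_le_of_lt (Finset.mem_filter.mp hij).right (Fin.is_lt ij.1)),
        ij.1.succ)
    apply Finset.sum_bij φ
    · intro ij hij
      simp_rw [S, φ, Finset.compl_filter, Finset.mem_filter_univ, Fin.val_succ,
        Fin.val_castLT] at hij ⊢
      lia
    · rintro ⟨i, j⟩ hij ⟨i', j'⟩ hij' h
      simp only [φ, Prod.mk.injEq, Fin.ext_iff, Fin.val_succ, Fin.val_castLT] at h ⊢
      omega
    · rintro ⟨i', j'⟩ hij'
      simp_rw [S, Finset.compl_filter, Finset.mem_filter_univ, not_le] at hij'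
      refine ⟨(j'.pred ?_, Fin.castSucc i'), ?_, ?_⟩
      · rintro rfl
        simp at hij'
      · simpa [S] using! Nat.le_sub_one_of_lt hij'
      · simp [φ]
    · rintro ⟨i, j⟩ hij
      have hij2 : (j : ℕ) ≤ (i : ℕ) := by simpa [S] using hij
      simp only [φ, face_face i j hij2, ← neg_smul]
      congr 1
      simp only [Fin.val_succ, Fin.val_castLT, pow_succ]
      ring
  exact LinearMap.congr_fun this c

/-! ### The parametrised chain complex -/

section Parametrised

variable {X : Type*} [MeasurableSpace X] (μ : Measure X)

/-- `L^∞(X, μ; ℤ)`: essentially bounded measurable functions `X → ℤ` up to `μ`-a.e. equality. -/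
def LInftyZ {X : Type*} [MeasurableSpace X] (μ : Measure X) : Type _ := Lp ℤ ∞ μ

instance {X : Type*} [MeasurableSpace X] (μ : Measure X) : AddCommGroup (LInftyZ μ) :=
  inferInstanceAs (AddCommGroup (Lp ℤ ∞ μ))

/-- The identification of `L^∞(X, μ; ℤ)` with the corresponding Lebesgue space of Mathlib. -/
def toLp {X : Type*} [MeasurableSpace X] {μ : Measure X} : LInftyZ μ ≃+ Lp ℤ ∞ μ :=
  AddEquiv.refl _

/-- The `1`-norm `f ↦ ∫ |f| dμ` on `L^∞(X, μ; ℤ)`. -/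
def norm1 {X : Type*} [MeasurableSpace X] {μ : Measure X} (f : LInftyZ μ) : ℝ :=
  ∫ x, |((toLp f x : ℤ) : ℝ)| ∂μ

variable (Γ : Type*) [Group Γ] [MulAction Γ X] [MeasurableConstSMul Γ X] [SMulInvariantMeasure Γ X μ]
variable (E : Type*) [TopologicalSpace E] [MulAction Γ E] [ContinuousConstSMul Γ E]

/-- The canonical right action of `Γ` on `L^∞(X, μ; ℤ)`: `(f · γ)(x) = f (γ • x)`. -/
def rightMul {Γ : Type*} [Group Γ] {X : Type*} [MeasurableSpace X] {μ : Measure X} [MulAction Γ X]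
    [MeasurableConstSMul Γ X] [SMulInvariantMeasure Γ X μ] (f : LInftyZ μ) (γ : Γ) : LInftyZ μ :=
  toLp.symm (DomMulAct.mk γ • toLp f)

theorem rightMul_ae_eq {Γ : Type*} [Group Γ] {X : Type*} [MeasurableSpace X] {μ : Measure X}
    [MulAction Γ X] [MeasurableConstSMul Γ X] [SMulInvariantMeasure Γ X μ] (f : LInftyZ μ) (γ : Γ) :
    (toLp (rightMul f γ) : X → ℤ) =ᵐ[μ] fun x => toLp f (γ • x) :=
  DomMulAct.smul_Lp_ae_eq (DomMulAct.mk γ) (toLp f)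

theorem rightMul_rightMul {Γ : Type*} [Group Γ] {X : Type*} [MeasurableSpace X] {μ : Measure X}
    [MulAction Γ X] [MeasurableConstSMul Γ X] [SMulInvariantMeasure Γ X μ] (f : LInftyZ μ)
    (γ δ : Γ) : rightMul (rightMul f γ) δ = rightMul f (γ * δ) :=
  congrArg toLp.symm (mul_smul (DomMulAct.mk δ) (DomMulAct.mk γ) (toLp f)).symm

/-- The relations `(f · γ) ⊗ c = f ⊗ (γ • c)` that define the tensor product over `ℤΓ` as a
quotient of the tensor product over `ℤ`. -/
def balancedRel (n : ℕ) : AddSubgroup (LInftyZ μ ⊗[ℤ] SingChain E n) :=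
  AddSubgroup.closure {t | ∃ (f : LInftyZ μ) (γ : Γ) (c : SingChain E n),
    t = rightMul f γ ⊗ₜ[ℤ] c - f ⊗ₜ[ℤ] chainSMul γ n c}

/-- The parametrised chain group `L^∞(X, μ; ℤ) ⊗_{ℤΓ} C_n(E; ℤ)`. -/
abbrev ParamChain (n : ℕ) : Type _ :=
  (LInftyZ μ ⊗[ℤ] SingChain E n) ⧸ balancedRel μ Γ E n

/-- The elementary chain `f ⊗ σ`. -/
def elem {X : Type*} [MeasurableSpace X] (μ : Measure X) (Γ : Type*) [Group Γ] [MulAction Γ X]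
    [MeasurableConstSMul Γ X] [SMulInvariantMeasure Γ X μ]
    {E : Type*} [TopologicalSpace E] [MulAction Γ E] [ContinuousConstSMul Γ E] {n : ℕ}
    (f : LInftyZ μ) (σ : Simp E n) : ParamChain μ Γ E n :=
  QuotientAddGroup.mk' (balancedRel μ Γ E n) (f ⊗ₜ[ℤ] Finsupp.single σ (1 : ℤ))

/-- The boundary operator `id ⊗ ∂` on `L^∞(X, μ; ℤ) ⊗_ℤ C_*(E; ℤ)`. -/
def tensorBoundary (n : ℕ) :
    LInftyZ μ ⊗[ℤ] SingChain E (n + 1) →+ LInftyZ μ ⊗[ℤ] SingChain E n :=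
  (LinearMap.lTensor (LInftyZ μ) (singBoundary E n)).toAddMonoidHom

theorem tensorBoundary_tmul (n : ℕ) (f : LInftyZ μ) (c : SingChain E (n + 1)) :
    tensorBoundary μ E n (f ⊗ₜ c) = f ⊗ₜ singBoundary E n c := rfl

theorem balancedRel_le (n : ℕ) :
    balancedRel μ Γ E (n + 1) ≤ (balancedRel μ Γ E n).comap (tensorBoundary μ E n) := by
  refine (AddSubgroup.closure_le _).2 ?_
  rintro _ ⟨f, γ, c, rfl⟩
  refine AddSubgroup.subset_closure ⟨f, γ, singBoundary E n c, ?_⟩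
  simp only [map_sub, tensorBoundary_tmul, singBoundary_chainSMul]

/-- The boundary operator `id ⊗ ∂` of the parametrised chain complex. -/
def paramBoundary (n : ℕ) : ParamChain μ Γ E (n + 1) →+ ParamChain μ Γ E n :=
  QuotientAddGroup.map _ _ (tensorBoundary μ E n) (balancedRel_le μ Γ E n)

theorem paramBoundary_elem (n : ℕ) (f : LInftyZ μ) (σ : Simp E (n + 1)) :
    paramBoundary μ Γ E n (elem μ Γ f σ) =
      ∑ i : Fin (n + 2), (-1 : ℤ) ^ (i : ℕ) • elem μ Γ f (face i σ) := by
  change QuotientAddGroup.mk' (balancedRel μ Γ E n)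
    (tensorBoundary μ E n (f ⊗ₜ Finsupp.single σ 1)) = _
  rw [tensorBoundary_tmul, singBoundary_single, TensorProduct.tmul_sum, map_sum]
  refine Finset.sum_congr rfl fun i _ => ?_
  rw [elem, ← map_zsmul, TensorProduct.tmul_smul]

theorem paramBoundary_paramBoundary (n : ℕ) (c : ParamChain μ Γ E (n + 2)) :
    paramBoundary μ Γ E n (paramBoundary μ Γ E (n + 1) c) = 0 := by
  obtain ⟨t, rfl⟩ := QuotientAddGroup.mk'_surjective _ c
  change QuotientAddGroup.mk' _ (tensorBoundary μ E n (tensorBoundary μ E (n + 1) t)) = 0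
  have : tensorBoundary μ E n (tensorBoundary μ E (n + 1) t) = 0 := by
    induction t with
    | zero => simp
    | add x y hx hy => simp [hx, hy]
    | tmul f c => simp [tensorBoundary_tmul, singBoundary_singBoundary]
  rw [this, map_zero]

variable {Γ E}

/-- `∑ σ ∈ s, f σ ⊗ σ` is a reduced form of `c`: the sum is equal to `c`, and the simplices
in `s` belong to pairwise different `Γ`-orbits. -/
def IsReducedForm {n : ℕ} (c : ParamChain μ Γ E n) (s : Finset (Simp E n))
    (f : Simp E n → LInftyZ μ) : Prop :=
  (∀ σ ∈ s, ∀ τ ∈ s, τ ∈ MulAction.orbit Γ σ → σ = τ) ∧ c = ∑ σ ∈ s, elem μ Γ (f σ) σ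

/-- The parametrised `ℓ¹`-norm: the value of `∑ σ ∈ s, |f σ|` for a reduced form of `c`. All reduced
forms give the same value if the action of `Γ` on `E` is free, see `l1Norm_eq`. -/
def l1Norm {n : ℕ} (c : ParamChain μ Γ E n) : ℝ :=
  sInf {r : ℝ | ∃ s f, IsReducedForm μ c s f ∧ r = ∑ σ ∈ s, norm1 (f σ)}

/-! Every chain has a reduced form, and all reduced forms give the same value. -/

theorem elem_add {n : ℕ} (f g : LInftyZ μ) (σ : Simp E n) :
    elem μ Γ (f + g) σ = elem μ Γ f σ + elem μ Γ g σ := by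
  simp only [elem, TensorProduct.add_tmul, map_add]

theorem elem_smul {n : ℕ} (f : LInftyZ μ) (γ : Γ) (σ : Simp E n) :
    elem μ Γ f (γ • σ) = elem μ Γ (rightMul f γ) σ := by
  have h : rightMul f γ ⊗ₜ[ℤ] Finsupp.single σ (1 : ℤ) - f ⊗ₜ[ℤ] Finsupp.single (γ • σ) (1 : ℤ) ∈
      balancedRel μ Γ E n :=
    AddSubgroup.subset_closure ⟨f, γ, Finsupp.single σ 1, by rw [chainSMul_single]⟩
  exact ((QuotientAddGroup.eq_iff_sub_mem).2 h).symm

theorem exists_isReducedForm {n : ℕ} (c : ParamChain μ Γ E n) :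
    ∃ s f, IsReducedForm μ c s f := by
  classical
  obtain ⟨t, rfl⟩ := QuotientAddGroup.mk'_surjective _ c
  -- it suffices to use one representative of each orbit
  let R : Simp E n → Simp E n := fun σ => Quotient.out (s := MulAction.orbitRel Γ (Simp E n)) ⟦σ⟧
  have hR : ∀ σ : Simp E n, ∃ γ : Γ, γ • R σ = σ := fun σ =>
    MulAction.orbitRel_apply.1 ((MulAction.orbitRel Γ (Simp E n)).symm
      (Quotient.mk_out (s := MulAction.orbitRel Γ (Simp E n)) σ))
  have hR' : ∀ σ τ : Simp E n, τ ∈ MulAction.orbit Γ σ → R σ = R τ := fun σ τ h =>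
    congrArg Quotient.out (Quotient.sound ((MulAction.orbitRel Γ (Simp E n)).symm
      (MulAction.orbitRel_apply.2 h)))
  have hRR : ∀ σ, R (R σ) = R σ := fun σ => hR' _ _ (hR σ)
  suffices h : ∃ (s : Finset (Simp E n)) (f : Simp E n → LInftyZ μ), (∀ σ ∈ s, R σ = σ) ∧
      QuotientAddGroup.mk' (balancedRel μ Γ E n) t = ∑ σ ∈ s, elem μ Γ (f σ) σ by
    obtain ⟨s, f, h1, h2⟩ := h
    exact ⟨s, f, fun σ hσ τ hτ h => by rw [← h1 σ hσ, ← h1 τ hτ, hR' σ τ h], h2⟩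
  have hadd : ∀ x y : ParamChain μ Γ E n,
      (∃ (s : Finset (Simp E n)) (f : Simp E n → LInftyZ μ), (∀ σ ∈ s, R σ = σ) ∧
        x = ∑ σ ∈ s, elem μ Γ (f σ) σ) →
      (∃ (s : Finset (Simp E n)) (f : Simp E n → LInftyZ μ), (∀ σ ∈ s, R σ = σ) ∧
        y = ∑ σ ∈ s, elem μ Γ (f σ) σ) →
      (∃ (s : Finset (Simp E n)) (f : Simp E n → LInftyZ μ), (∀ σ ∈ s, R σ = σ) ∧
        x + y = ∑ σ ∈ s, elem μ Γ (f σ) σ) := by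
    rintro x y ⟨s, f, hs, rfl⟩ ⟨s', f', hs', rfl⟩
    refine ⟨s ∪ s', fun σ => (if σ ∈ s then f σ else 0) + if σ ∈ s' then f' σ else 0, ?_, ?_⟩
    · intro σ hσ
      rcases Finset.mem_union.1 hσ with h | h
      exacts [hs σ h, hs' σ h]
    · have h0 : ∀ σ : Simp E n, elem μ Γ (0 : LInftyZ μ) σ = 0 := fun σ => by simp [elem]
      simp only [elem_add, Finset.sum_add_distrib]
      congr 1
      · rw [← Finset.sum_subset (Finset.subset_union_left (s₂ := s'))]
        · exact Finset.sum_congr rfl fun σ hσ => by simp [hσ]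
        · intro σ _ hσ
          simp [hσ, h0]
      · rw [← Finset.sum_subset (Finset.subset_union_right (s₁ := s))]
        · exact Finset.sum_congr rfl fun σ hσ => by simp [hσ]
        · intro σ _ hσ
          simp [hσ, h0]
  induction t with
  | zero => exact ⟨∅, 0, by simp, by simp⟩
  | add x y hx hy => rw [map_add]; exact hadd _ _ hx hy
  | tmul f c =>
    induction c using Finsupp.induction_linear with
    | zero => exact ⟨∅, 0, by simp, by simp⟩
    | add x y hx hy => rw [TensorProduct.tmul_add, map_add]; exact hadd _ _ hx hy
    | single σ m =>
      obtain ⟨γ, hγ⟩ := hR σ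
      refine ⟨{R σ}, fun _ => rightMul (m • f) γ, by simp [hRR], ?_⟩
      rw [Finset.sum_singleton, ← elem_smul, hγ, elem]
      congr 1
      rw [TensorProduct.smul_tmul]
      simp

theorem norm1_zero : norm1 (0 : LInftyZ μ) = 0 := by
  have : (fun x => |((toLp (0 : LInftyZ μ) x : ℤ) : ℝ)|) =ᵐ[μ] fun _ => (0 : ℝ) := by
    filter_upwards [Lp.coeFn_zero ℤ ∞ μ] with x hx
    rw [map_zero, hx, Pi.zero_apply, Int.cast_zero, abs_zero]
  rw [norm1, integral_congr_ae this, integral_zero]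

theorem norm1_rightMul (f : LInftyZ μ) (γ : Γ) : norm1 (rightMul f γ) = norm1 f := by
  have : (fun x => |((toLp (rightMul f γ) x : ℤ) : ℝ)|) =ᵐ[μ] fun x => |((toLp f (γ • x) : ℤ) : ℝ)| := by
    filter_upwards [rightMul_ae_eq f γ] with x hx
    rw [hx]
  rw [norm1, integral_congr_ae this]
  exact (measurePreserving_smul γ μ).integral_comp (measurableEmbedding_const_smul γ)
    fun x => |((toLp f x : ℤ) : ℝ)|

/-- The coefficient of a chain at the orbit of `σ`, for a free action on simplices. -/
theorem exists_coeff {n : ℕ} (hfree : ∀ (γ : Γ) (σ : Simp E n), γ • σ = σ → γ = 1)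
    (σ : Simp E n) : ∃ L : ParamChain μ Γ E n →+ LInftyZ μ,
      (∀ (f : LInftyZ μ) (γ : Γ), L (elem μ Γ f (γ • σ)) = rightMul f γ) ∧
      ∀ (f : LInftyZ μ) (τ : Simp E n), τ ∉ MulAction.orbit Γ σ → L (elem μ Γ f τ) = 0 := by
  classical
  let r (γ : Γ) : LInftyZ μ →ₗ[ℤ] LInftyZ μ := AddMonoidHom.toIntLinearMap
    { toFun := fun f => rightMul f γ
      map_zero' := congrArg toLp.symm (smul_zero (DomMulAct.mk γ))
      map_add' := fun f g => congrArg toLp.symm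
        (smul_add (DomMulAct.mk γ) (toLp f) (toLp g)) }
  let T (τ : Simp E n) : LInftyZ μ →ₗ[ℤ] LInftyZ μ :=
    if h : ∃ γ : Γ, γ • σ = τ then r h.choose else 0
  have hT : ∀ (γ : Γ) (f : LInftyZ μ), T (γ • σ) f = rightMul f γ := by
    intro γ f
    have h : ∃ δ : Γ, δ • σ = γ • σ := ⟨γ, rfl⟩
    have h2 : h.choose = γ := by
      have := hfree (γ⁻¹ * h.choose) σ (by rw [mul_smul, h.choose_spec, inv_smul_smul])
      exact (inv_mul_eq_one.1 this).symm
    simp only [T, dif_pos h, h2]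
    rfl
  have hT0 : ∀ τ, τ ∉ MulAction.orbit Γ σ → T τ = 0 := fun τ h => dif_neg h
  let B : LInftyZ μ ⊗[ℤ] SingChain E n →ₗ[ℤ] LInftyZ μ :=
    TensorProduct.lift (LinearMap.flip (Finsupp.linearCombination ℤ T))
  have hB : ∀ f τ, B (f ⊗ₜ Finsupp.single τ 1) = T τ f := fun f τ =>
    (TensorProduct.lift.tmul _ _).trans (by simp)
  have hker : balancedRel μ Γ E n ≤ B.toAddMonoidHom.ker := by
    refine (AddSubgroup.closure_le _).2 ?_
    rintro _ ⟨f, γ, c, rfl⟩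
    refine (AddMonoidHom.mem_ker).2 ?_
    change B (rightMul f γ ⊗ₜ[ℤ] c - f ⊗ₜ[ℤ] (chainSMul γ n) c) = 0
    rw [map_sub, sub_eq_zero]
    induction c using Finsupp.induction_linear with
    | zero => simp
    | add x y hx hy => simp only [map_add, TensorProduct.tmul_add, hx, hy]
    | single τ m =>
      have key : T τ (rightMul f γ) = T (γ • τ) f := by
        by_cases h : τ ∈ MulAction.orbit Γ σ
        · obtain ⟨δ, rfl⟩ := h
          change T (δ • σ) _ = T (γ • δ • σ) f
          rw [hT, smul_smul, hT]
          rw [rightMul_rightMul]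
        · have h' : γ • τ ∉ MulAction.orbit Γ σ := fun h' => by
            obtain ⟨δ, hδ⟩ := h'
            exact h ⟨γ⁻¹ * δ, (mul_smul _ _ _).trans (inv_smul_eq_iff.2 hδ)⟩
          rw [hT0 _ h, hT0 _ h']
          rfl
      rw [chainSMul_single]
      have hm : ∀ ρ : Simp E n, Finsupp.single ρ m = m • Finsupp.single ρ (1 : ℤ) := by simp
      rw [hm, hm, TensorProduct.tmul_smul, TensorProduct.tmul_smul, map_smul, map_smul, hB, hB, key]
  refine ⟨QuotientAddGroup.lift _ B.toAddMonoidHom hker, fun f γ => ?_, fun f τ h => ?_⟩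
  · exact (hB f _).trans (hT γ f)
  · exact (hB f _).trans (by rw [hT0 τ h]; rfl)

theorem IsReducedForm.sum_eq {n : ℕ} (hfree : ∀ (γ : Γ) (σ : Simp E n), γ • σ = σ → γ = 1)
    {c : ParamChain μ Γ E n} {s s' : Finset (Simp E n)} {f f' : Simp E n → LInftyZ μ}
    (h : IsReducedForm μ c s f) (h' : IsReducedForm μ c s' f') :
    ∑ σ ∈ s, norm1 (f σ) = ∑ σ ∈ s', norm1 (f' σ) := by
  classical
  choose L hL hL0 using exists_coeff μ (Γ := Γ) hfree
  have hrm : ∀ g : LInftyZ μ, rightMul g (1 : Γ) = g := fun g => congrArg toLp.symm (one_smul _ (toLp g))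
  have hLs : ∀ {s : Finset (Simp E n)} {f : Simp E n → LInftyZ μ}, IsReducedForm μ c s f →
      ∀ σ : Simp E n, norm1 (L σ c) =
        ∑ τ ∈ s, if τ ∈ MulAction.orbit Γ σ then norm1 (f τ) else 0 := by
    intro s f h σ
    by_cases hs : ∃ τ ∈ s, τ ∈ MulAction.orbit Γ σ
    · obtain ⟨τ, hτ, γ, rfl⟩ := hs
      have hne : ∀ ρ ∈ s, ρ ≠ γ • σ → ρ ∉ MulAction.orbit Γ σ := fun ρ hρ hn ho =>
        hn (h.1 _ hτ ρ hρ (by rwa [MulAction.orbit_smul])).symm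
      rw [Finset.sum_eq_single_of_mem _ hτ fun ρ hρ hn => if_neg (hne ρ hρ hn), h.2, map_sum,
        Finset.sum_eq_single_of_mem _ hτ fun ρ hρ hn => hL0 σ _ ρ (hne ρ hρ hn)]
      rw [if_pos ⟨γ, rfl⟩]
      change norm1 (L σ (elem μ Γ (f (γ • σ)) (γ • σ))) = _
      rw [hL, norm1_rightMul]
    · push Not at hs
      rw [h.2, map_sum, Finset.sum_eq_zero fun τ hτ => hL0 σ _ τ (hs τ hτ), norm1_zero,
        Finset.sum_eq_zero fun τ hτ => if_neg (hs τ hτ)]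
  have hf : ∀ {s : Finset (Simp E n)} {f : Simp E n → LInftyZ μ}, IsReducedForm μ c s f →
      ∀ σ ∈ s, f σ = L σ c := by
    intro s f h σ hσ
    rw [h.2, map_sum, Finset.sum_eq_single_of_mem _ hσ fun τ hτ hn =>
      hL0 σ _ τ fun ho => hn (h.1 σ hσ τ hτ ho).symm]
    have := hL σ (f σ) 1
    rw [one_smul, hrm] at this
    exact this.symm
  have e1 : ∑ σ ∈ s, norm1 (f σ) =
      ∑ σ ∈ s, ∑ τ ∈ s', if τ ∈ MulAction.orbit Γ σ then norm1 (f' τ) else 0 :=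
    Finset.sum_congr rfl fun σ hσ => by rw [hf h σ hσ, hLs h']
  have e2 : ∑ τ ∈ s', norm1 (f' τ) =
      ∑ τ ∈ s', ∑ σ ∈ s, if σ ∈ MulAction.orbit Γ τ then norm1 (f σ) else 0 :=
    Finset.sum_congr rfl fun τ hτ => by rw [hf h' τ hτ, hLs h]
  rw [e1, e2, Finset.sum_comm]
  refine Finset.sum_congr rfl fun τ hτ => Finset.sum_congr rfl fun σ hσ => ?_
  by_cases ho : τ ∈ MulAction.orbit Γ σ
  · rw [if_pos ho, if_pos (MulAction.mem_orbit_symm.1 ho), hf h' τ hτ, hf h σ hσ, hLs h,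
      Finset.sum_eq_single_of_mem σ hσ fun ρ hρ hn => if_neg fun hρo => hn ?_,
      if_pos (MulAction.mem_orbit_symm.1 ho), hf h σ hσ]
    exact (h.1 σ hσ ρ hρ (by rwa [MulAction.orbit_eq_iff.2 ho] at hρo)).symm
  · rw [if_neg ho, if_neg fun h => ho (MulAction.mem_orbit_symm.1 h)]

theorem l1Norm_eq {n : ℕ} (hfree : ∀ (γ : Γ) (σ : Simp E n), γ • σ = σ → γ = 1)
    {c : ParamChain μ Γ E n} {s : Finset (Simp E n)} {f : Simp E n → LInftyZ μ}
    (h : IsReducedForm μ c s f) : l1Norm μ c = ∑ σ ∈ s, norm1 (f σ) := by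
  have : {r : ℝ | ∃ s f, IsReducedForm μ c s f ∧ r = ∑ σ ∈ s, norm1 (f σ)} =
      {∑ σ ∈ s, norm1 (f σ)} := by
    ext r
    constructor
    · rintro ⟨s', f', h', rfl⟩
      exact h'.sum_eq μ hfree h
    · rintro rfl
      exact ⟨s, f, h, rfl⟩
  rw [l1Norm, this, csInf_singleton]

/-- The group of deck transformations acts freely on singular simplices. -/
theorem IsUniversalCovering.free {M : Type*} [TopologicalSpace M] {p : E → M}
    (hp : IsUniversalCovering Γ p) {n : ℕ} (γ : Γ) (σ : Simp E n) (h : γ • σ = σ) : γ = 1 := by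
  have := hp.simplyConnectedSpace
  refine hp.faithful γ fun e => congrFun (hp.isCoveringMap.eq_of_comp_eq
    (continuous_const_smul γ) continuous_id (funext fun e => hp.proj_smul γ e)
    (σ (stdSimplex.vertex 0)) (DFunLike.congr_fun h (stdSimplex.vertex 0))) e

end Parametrised

/-- The uniform boundary condition in degree `n` for a sequence of abelian groups `C n` with
boundary operators `∂` and norms: a constant `K > 0` exists such that every null-homologous
cycle `c` (every `c` in the image of `∂`) has a filling `b` with `|b| ≤ K * |c|`. -/
def UBC {C : ℕ → Type*} [∀ n, AddCommGroup (C n)] (bd : ∀ n, C (n + 1) →+ C n)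
    (nrm : ∀ n, C n → ℝ) (n : ℕ) : Prop :=
  ∃ K : ℝ, 0 < K ∧ ∀ c : C n, (∃ b₀ : C (n + 1), bd n b₀ = c) →
    ∃ b : C (n + 1), bd n b = c ∧ nrm (n + 1) b ≤ K * nrm n c

end ParamUBC

end

/-!
The constant `K = 2` works in every degree.

Let `c = ∂ b₀` be a boundary, and lift `b₀` to a chain `w` of `L^∞(X; ℤ) ⊗_ℤ C_*(E; ℤ)`, where no
coinvariants are taken. On this complex there is a norm non-increasing cone operator, since the
universal covering `E` of the torus is homeomorphic to `ℝ ^ d`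
(`IsUniversalCovering.exists_homeomorph`), and the cone over `∂ w` is a filling of `∂ w`
(`freeBoundary_coneChain_freeBoundary`). Hence `c` has a filling of norm at most `|∂ w|`, and it
remains to choose the lift `w` of `b₀` in such a way that `∂ w`, which is a lift of `c`, has a norm
close to `|c|`. Cancellation between simplices in the same `Γ`-orbit is lost in an arbitrary lift.

Lifts are changed by means of measurable maps `a : X → Γ` with finite image: the part of `f ⊗ σ` over
`x ∈ X` is translated by `a x` (`moveChain`). This operation commutes with the boundary operator, does
not increase the norm and does not change the parametrised chain that is represented. If `a` were
equivariant in the sense that `a (δ • x) * δ = a x`, then `f ⊗ δ • σ` and `(f · δ) ⊗ σ` would be moved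
to the same chain, so that moving `∂ w` would reduce its norm to `|c|`. Equivariance up to a set of
small measure, for finitely many `δ`, reduces the norm to `|c| + ε`
(`exists_freeNorm_moveChain_le`), and if `c ≠ 0`, then `ε = |c|` is good enough.

Almost equivariant maps `a` exist for all essentially free measure preserving actions of subgroups of
`ℤ ^ d` (`exists_almost_equivariant`); this is where the geometry of the deck transformation group
enters. A maximal `R`-separated measurable set `B` of base points is chosen in the orbits, and every
`x` is assigned to one of the base points at distance at most `r`, namely the first one in a fixed
linear order on `X`. The points `x` and `δ • x` can be assigned to different base points only if `x`
is close to the sphere of radius `r` around some base point. The number of base points at distance at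
most `3 * R` from `x` is bounded independently of `R`, so that for large `R` and a typical radius
`R ≤ r < 2 * R` only few points `x` have this property.
-/

noncomputable section

namespace ParamUBC

/-! ### The universal covering of the torus -/

theorem locallyPathConnectedSpace_of_isLocalHomeomorph {E M : Type*} [TopologicalSpace E]
    [TopologicalSpace M] [LocallyPathConnectedSpace M] {p : E → M} (hp : IsLocalHomeomorph p) :
    LocallyPathConnectedSpace E := by
  choose f hf _ using hp
  let _ : ChartedSpace M E :=
    { atlas := Set.range f
      chartAt := f
      mem_chart_source := hf
      chart_mem_atlas := fun x => ⟨x, rfl⟩ }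
  exact ChartedSpace.locallyPathConnectedSpace M E

instance : LocallyPathConnectedSpace Circle :=
  (Circle.isCoveringMap_exp.isQuotientMap fun z =>
    ⟨Complex.arg z, Circle.exp_arg z⟩).locallyPathConnectedSpace

/-- A universal covering of the torus is homeomorphic to `ℝ ^ d`, compatibly with the coordinatewise
exponential map. -/
theorem IsUniversalCovering.exists_homeomorph {d : ℕ} {Γ : Type*} [Group Γ] {E : Type*}
    [TopologicalSpace E] [MulAction Γ E] [ContinuousConstSMul Γ E] {p : E → (Fin d → Circle)}
    (hp : IsUniversalCovering Γ p) :
    ∃ h : E ≃ₜ (Fin d → ℝ), ∀ e j, Circle.exp (h e j) = p e j := by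
  have := hp.simplyConnectedSpace
  have := locallyPathConnectedSpace_of_isLocalHomeomorph hp.isCoveringMap.isLocalHomeomorph
  obtain ⟨e₀⟩ : Nonempty E := inferInstance
  have hpj : ∀ j, Continuous fun e => p e j := fun j =>
    (continuous_apply j).comp hp.isCoveringMap.continuous
  have hlift : ∀ j, ∃ F : C(E, ℝ), ∀ e, Circle.exp (F e) = p e j := by
    intro j
    obtain ⟨F, ⟨-, hF⟩, -⟩ := Circle.isCoveringMap_exp.existsUnique_continuousMap_lifts
      ⟨fun e => p e j, hpj j⟩ e₀ (Complex.arg (p e₀ j)) (Circle.exp_arg _)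
    exact ⟨F, fun e => congrFun hF e⟩
  choose F hF using hlift
  let h : C(E, Fin d → ℝ) := ⟨fun e j => F j e, by fun_prop⟩
  have hq : Continuous fun (v : Fin d → ℝ) (j : Fin d) => Circle.exp (v j) := by fun_prop
  obtain ⟨g, ⟨hg₀, hg⟩, -⟩ := hp.isCoveringMap.existsUnique_continuousMap_lifts
    ⟨_, hq⟩ (h e₀) e₀ (funext fun j => (hF j e₀).symm)
  have hg' : ∀ v j, p (g v) j = Circle.exp (v j) := fun v j => congrFun (congrFun hg v) j
  refine ⟨⟨⟨h, g, fun e => ?_, fun v => ?_⟩, h.continuous, g.continuous⟩, fun e j => hF j e⟩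
  · refine congrFun (hp.isCoveringMap.eq_of_comp_eq (g₁ := fun e => g (h e)) (g₂ := id)
      (by fun_prop) continuous_id ?_ e₀ hg₀) e
    funext e j
    exact (hg' (h e) j).trans (hF j e)
  · funext j
    refine congrFun (Circle.isCoveringMap_exp.eq_of_comp_eq (g₁ := fun v => h (g v) j)
      (g₂ := fun v => v j) (by fun_prop) (by fun_prop) ?_ (h e₀) (by rw [hg₀])) v
    funext v
    exact (hF j (g v)).trans (hg' v j)

/-- The deck transformations of the torus embed into `ℤ ^ d` by their translation vectors. -/
theorem IsUniversalCovering.exists_injective_hom {d : ℕ} {Γ : Type*} [Group Γ] {E : Type*}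
    [TopologicalSpace E] [MulAction Γ E] [ContinuousConstSMul Γ E] {p : E → (Fin d → Circle)}
    (hp : IsUniversalCovering Γ p) :
    ∃ ψ : Γ → Fin d → ℤ, (∀ γ δ, ψ (γ * δ) = ψ γ + ψ δ) ∧ Function.Injective ψ := by
  have := hp.simplyConnectedSpace
  obtain ⟨h, hh⟩ := hp.exists_homeomorph
  obtain ⟨e₀⟩ : Nonempty E := inferInstance
  have hconst : ∀ γ : Γ, ∀ e j, h (γ • e) j - h e j = h (γ • e₀) j - h e₀ j := by
    intro γ e j
    refine Circle.isCoveringMap_exp.const_of_comp (g := fun e => h (γ • e) j - h e j) ?_ ?_ e e₀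
    · fun_prop
    · intro a a'
      simp only [Circle.exp_sub, hh, hp.proj_smul, div_self']
  have hint : ∀ γ : Γ, ∀ j, ∃ m : ℤ, h (γ • e₀) j - h e₀ j = m * (2 * Real.pi) := by
    intro γ j
    refine Circle.exp_eq_one.1 ?_
    simp only [Circle.exp_sub, hh, hp.proj_smul, div_self']
  choose ψ hψ using hint
  have htr : ∀ γ e j, h (γ • e) j = h e j + ψ γ j * (2 * Real.pi) := fun γ e j => by
    rw [← hψ, ← hconst γ e j, add_sub_cancel]
  have hmul : ∀ γ δ, ψ (γ * δ) = ψ γ + ψ δ := by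
    intro γ δ
    funext j
    have h1 := htr (γ * δ) e₀ j
    rw [mul_smul, htr, htr] at h1
    have h2 : ((ψ (γ * δ) j : ℝ) - (ψ γ j + ψ δ j)) * (2 * Real.pi) = 0 := by linarith
    have h3 := (mul_eq_zero.1 h2).resolve_right (by positivity)
    have h4 : (ψ (γ * δ) j : ℝ) = ((ψ γ j + ψ δ j : ℤ) : ℝ) := by push_cast; linarith
    exact_mod_cast h4
  refine ⟨ψ, hmul, fun γ δ hγδ => ?_⟩
  have : δ⁻¹ * γ = 1 := hp.faithful _ fun e => by
    rw [mul_smul, inv_smul_eq_iff]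
    exact h.injective (funext fun j => by rw [htr, htr, hγδ])
  exact (inv_mul_eq_one.1 this).symm

/-! ### Balls and packings in lattices -/

/-- The sup-norm length of a group element whose translation vector in `ℤ ^ d` is given by `ψ`. -/
def latticeLength {Γ : Type*} {d : ℕ} (ψ : Γ → Fin d → ℤ) (γ : Γ) : ℕ :=
  Finset.univ.sup fun i => (ψ γ i).natAbs

theorem latticeLength_le_iff {Γ : Type*} {d : ℕ} {ψ : Γ → Fin d → ℤ} {γ : Γ} {r : ℕ} :
    latticeLength ψ γ ≤ r ↔ ∀ i, (ψ γ i).natAbs ≤ r := by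
  simp [latticeLength]

theorem finite_latticeLength_le {Γ : Type*} {d : ℕ} {ψ : Γ → Fin d → ℤ}
    (hinj : Function.Injective ψ) (r : ℕ) :
    {γ : Γ | latticeLength ψ γ ≤ r}.Finite := by
  refine Set.Finite.of_finite_image (f := ψ) ?_ hinj.injOn
  refine (Set.finite_Icc (fun _ => -(r : ℤ)) fun _ => (r : ℤ)).subset ?_
  rintro _ ⟨γ, hγ, rfl⟩
  have := latticeLength_le_iff.1 hγ
  exact ⟨fun i => by have := this i; simp only; omega, fun i => by have := this i; simp only; omega⟩

section Lattice

variable {Γ : Type*} [Group Γ] {d : ℕ} {ψ : Γ → Fin d → ℤ}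

theorem latticeLength_mul_le (hψ : ∀ γ δ, ψ (γ * δ) = ψ γ + ψ δ) (γ δ : Γ) :
    latticeLength ψ (γ * δ) ≤ latticeLength ψ γ + latticeLength ψ δ := by
  refine latticeLength_le_iff.2 fun i => ?_
  have h1 := latticeLength_le_iff.1 (le_refl (latticeLength ψ γ)) i
  have h2 := latticeLength_le_iff.1 (le_refl (latticeLength ψ δ)) i
  rw [hψ, Pi.add_apply]
  omega

theorem map_inv_of_map_mul (hψ : ∀ γ δ, ψ (γ * δ) = ψ γ + ψ δ) (γ : Γ) : ψ γ⁻¹ = -ψ γ := by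
  have h1 : ψ 1 = 0 := by simpa using hψ 1 1
  have h2 := hψ γ⁻¹ γ
  rw [inv_mul_cancel, h1] at h2
  exact eq_neg_of_add_eq_zero_left h2.symm

theorem latticeLength_inv (hψ : ∀ γ δ, ψ (γ * δ) = ψ γ + ψ δ) (γ : Γ) :
    latticeLength ψ γ⁻¹ = latticeLength ψ γ := by
  simp [latticeLength, map_inv_of_map_mul hψ]

/-- A packing bound that does not depend on the scale: an `R`-separated subset of a ball of radius
`3 * R` in `ℤ ^ d` has at most `7 ^ d` elements. -/
theorem card_le_of_separated (hψ : ∀ γ δ, ψ (γ * δ) = ψ γ + ψ δ)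
    {R : ℕ} (hR : 0 < R) (s : Finset Γ) (hs : ∀ γ ∈ s, latticeLength ψ γ ≤ 3 * R)
    (hsep : ∀ γ ∈ s, ∀ δ ∈ s, latticeLength ψ (γ * δ⁻¹) ≤ R → γ = δ) : s.card ≤ 7 ^ d := by
  classical
  -- two elements of the set cannot lie in the same cube of side length `R`
  have hcard : (Fintype.piFinset fun _ : Fin d => Finset.Icc (-3 : ℤ) 3).card = 7 ^ d := by
    simp
  rw [← hcard]
  have hR' : (0 : ℤ) < R := by exact_mod_cast hR
  refine Finset.card_le_card_of_injOn (fun γ i => ψ γ i / R) ?_ ?_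
  · intro γ hγ
    rw [Finset.mem_coe, Fintype.mem_piFinset]
    intro i
    have := latticeLength_le_iff.1 (hs γ hγ) i
    rw [Finset.mem_Icc]
    constructor
    · rw [Int.le_ediv_iff_mul_le hR']
      omega
    · have : ψ γ i / R < 4 := by
        rw [Int.ediv_lt_iff_lt_mul hR']
        omega
      exact Int.lt_add_one_iff.1 this
  · intro γ hγ δ hδ h
    refine hsep γ hγ δ hδ (latticeLength_le_iff.2 fun i => ?_)
    have hi : ψ γ i / R = ψ δ i / R := congrFun h i
    rw [hψ, map_inv_of_map_mul hψ, Pi.add_apply, Pi.neg_apply]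
    have h1 := Int.emod_add_mul_ediv (ψ γ i) R
    have h2 := Int.emod_add_mul_ediv (ψ δ i) R
    have h3 := Int.emod_nonneg (ψ γ i) hR'.ne'
    have h4 := Int.emod_nonneg (ψ δ i) hR'.ne'
    have h5 := Int.emod_lt_of_pos (ψ γ i) hR'
    have h6 := Int.emod_lt_of_pos (ψ δ i) hR'
    rw [hi] at h1
    omega

end Lattice

/-! ### Almost equivariant maps to the group -/

/-- A free action on a standard Borel space has, for every finite symmetric set `U` of non-trivial
group elements, a measurable set that is maximal among those that do not contain both `x` and
`γ • x` for any `γ ∈ U`. -/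
theorem exists_measurableSet_marker {Γ X : Type*} [Group Γ] [MulAction Γ X] [MeasurableSpace X]
    [StandardBorelSpace X] [MeasurableConstSMul Γ X] (U : Finset Γ) (hU1 : (1 : Γ) ∉ U)
    (hU : ∀ γ ∈ U, γ⁻¹ ∈ U) :
    ∃ B : Set X, MeasurableSet B ∧ (∀ x ∈ B, ∀ γ ∈ U, γ • x ∉ B) ∧
      ∀ x : X, (∀ γ : Γ, γ • x = x → γ = 1) → x ∈ B ∨ ∃ γ ∈ U, γ • x ∈ B := by
  have hφ := measurableEmbedding_embeddingReal X
  set φ : X → ℝ := embeddingReal X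
  have hsmul : ∀ γ : Γ, Measurable fun x : X => γ • x := fun γ => measurable_const_smul γ
  -- a countable family of sets, each of them disjoint from its translates by `U`, that covers
  -- the free part of the action
  let A : ℚ × ℚ → Set X := fun q =>
    {x | φ x ∈ Set.Ioo (q.1 : ℝ) q.2} ∩ ⋂ γ ∈ U, {x | φ (γ • x) ∉ Set.Ioo (q.1 : ℝ) q.2}
  have hAm : ∀ q, MeasurableSet (A q) := fun q =>
    (hφ.measurable measurableSet_Ioo).inter (Finset.measurableSet_biInter _ fun γ _ =>
      ((hφ.measurable.comp (hsmul γ)) measurableSet_Ioo).compl)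
  have hAsep : ∀ q, ∀ x ∈ A q, ∀ γ ∈ U, γ • x ∉ A q := by
    intro q x hx γ hγ hx'
    exact (Set.mem_iInter₂.1 hx.2 γ hγ) hx'.1
  have hAcov : ∀ x : X, (∀ γ : Γ, γ • x = x → γ = 1) → ∃ q, x ∈ A q := by
    intro x hx
    have hopen : IsOpen ((U.image fun γ => φ (γ • x) : Finset ℝ) : Set ℝ)ᶜ :=
      (Finset.finite_toSet _).isClosed.isOpen_compl
    have hmem : φ x ∈ ((U.image fun γ => φ (γ • x) : Finset ℝ) : Set ℝ)ᶜ := by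
      intro h
      obtain ⟨γ, hγ, h⟩ := Finset.mem_image.1 (Finset.mem_coe.1 h)
      exact hU1 (hx γ (hφ.injective h) ▸ hγ)
    obtain ⟨_, ha, hxa, hsub⟩ :=
      Real.isTopologicalBasis_Ioo_rat.exists_subset_of_mem_open hmem hopen
    simp only [Set.mem_iUnion, Set.mem_singleton_iff] at ha
    obtain ⟨a, b, -, rfl⟩ := ha
    refine ⟨(a, b), hxa, Set.mem_iInter₂.2 fun γ hγ h => hsub h ?_⟩
    exact Finset.mem_coe.2 (Finset.mem_image_of_mem _ hγ)
  obtain ⟨e, he⟩ := exists_surjective_nat (ℚ × ℚ)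
  -- greedy construction along the family
  let B : ℕ → Set X := fun n => Nat.rec ∅ (fun k Bk =>
    Bk ∪ (A (e k) \ ⋃ γ ∈ U, {x | γ • x ∈ Bk})) n
  have hBs : ∀ n, B (n + 1) = B n ∪ (A (e n) \ ⋃ γ ∈ U, {x | γ • x ∈ B n}) := fun n => rfl
  have hBm : ∀ n, MeasurableSet (B n) := by
    intro n
    induction n with
    | zero => exact MeasurableSet.empty
    | succ n ih =>
      rw [hBs]
      exact ih.union ((hAm _).diff (Finset.measurableSet_biUnion _ fun γ _ => hsmul γ ih))
  have hBsep : ∀ n, ∀ x ∈ B n, ∀ γ ∈ U, γ • x ∉ B n := by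
    intro n
    induction n with
    | zero => exact fun x hx => hx.elim
    | succ n ih =>
      rw [hBs]
      rintro x (hx | hx) γ hγ (hx' | hx')
      · exact ih x hx γ hγ hx'
      · exact hx'.2 (Set.mem_iUnion₂.2 ⟨γ⁻¹, hU γ hγ, by simpa using hx⟩)
      · exact hx.2 (Set.mem_iUnion₂.2 ⟨γ, hγ, hx'⟩)
      · exact hAsep _ x hx.1 γ hγ hx'.1
  have hBmono : Monotone B := monotone_nat_of_le_succ fun n => by
    rw [hBs]
    exact Set.subset_union_left
  refine ⟨⋃ n, B n, MeasurableSet.iUnion hBm, fun x hx γ hγ hx' => ?_, fun x hx => ?_⟩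
  · obtain ⟨n, hn⟩ := Set.mem_iUnion.1 hx
    obtain ⟨m, hm⟩ := Set.mem_iUnion.1 hx'
    exact hBsep (max n m) x (hBmono (le_max_left _ _) hn) γ hγ (hBmono (le_max_right _ _) hm)
  · obtain ⟨q, hq⟩ := hAcov x hx
    obtain ⟨n, rfl⟩ := he q
    rcases em (∃ γ ∈ U, γ • x ∈ B n) with h | h
    · obtain ⟨γ, hγ, h⟩ := h
      exact Or.inr ⟨γ, hγ, Set.mem_iUnion.2 ⟨n, h⟩⟩
    · refine Or.inl (Set.mem_iUnion.2 ⟨n + 1, ?_⟩)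
      rw [hBs]
      refine Or.inr ⟨hq, fun h' => h ?_⟩
      obtain ⟨γ, hγ, h'⟩ := Set.mem_iUnion₂.1 h'
      exact ⟨γ, hγ, h'⟩

/-- A measurable choice of an element of a finite subset `F` of `Γ` that moves `x` to the point of
`B` with the smallest value of `φ`. -/
theorem exists_measurable_argmin {Γ X : Type*} [Group Γ] [Countable Γ] [MulAction Γ X]
    [MeasurableSpace X] [MeasurableConstSMul Γ X] {B : Set X} (hB : MeasurableSet B)
    {φ : X → ℝ} (hφ : Measurable φ) (F : Finset Γ) :
    ∃ a : X → Γ, (∀ γ, MeasurableSet {x | a x = γ}) ∧ (Set.range a).Finite ∧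
      ∀ x, (∃ γ ∈ F, γ • x ∈ B) →
        a x ∈ F ∧ a x • x ∈ B ∧ ∀ γ ∈ F, γ • x ∈ B → φ (a x • x) ≤ φ (γ • x) := by
  classical
  have hsmul : ∀ γ : Γ, Measurable fun x : X => γ • x := fun γ => measurable_const_smul γ
  let Q : X → Γ → Prop := fun x γ =>
    γ ∈ F ∧ γ • x ∈ B ∧ ∀ γ' ∈ F, γ' • x ∈ B → φ (γ • x) ≤ φ (γ' • x)
  have hQm : ∀ γ, MeasurableSet {x | Q x γ} := by
    intro γ
    refine (MeasurableSet.const _).inter ((hsmul γ hB).inter ?_)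
    have : {x : X | ∀ γ' ∈ F, γ' • x ∈ B → φ (γ • x) ≤ φ (γ' • x)} =
        ⋂ γ' ∈ F, ({x | γ' • x ∈ B}ᶜ ∪ {x | φ (γ • x) ≤ φ (γ' • x)}) := by
      ext x
      simp [imp_iff_not_or]
    change MeasurableSet {x : X | ∀ γ' ∈ F, γ' • x ∈ B → φ (γ • x) ≤ φ (γ' • x)}
    rw [this]
    exact Finset.measurableSet_biInter _ fun γ' _ => (hsmul γ' hB).compl.union
      (measurableSet_le (hφ.comp (hsmul γ)) (hφ.comp (hsmul γ')))
  obtain ⟨g, hg⟩ := exists_surjective_nat Γ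
  -- outside of the domain of interest the choice is the default value `g 0`
  let Q' : X → ℕ → Prop := fun x k => Q x (g k) ∨ ∀ γ, ¬ Q x γ
  have hQ' : ∀ x, ∃ k, Q' x k := by
    intro x
    by_cases h : ∃ γ, Q x γ
    · obtain ⟨γ, hγ⟩ := h
      obtain ⟨k, rfl⟩ := hg γ
      exact ⟨k, Or.inl hγ⟩
    · exact ⟨0, Or.inr (not_exists.1 h)⟩
  have hfind : Measurable fun x => Nat.find (hQ' x) := measurable_find hQ' fun k =>
    (hQm _).union (by
      have : {x | ∀ γ, ¬ Q x γ} = ⋂ γ, {x | Q x γ}ᶜ := by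
        ext x
        simp
      change MeasurableSet {x | ∀ γ, ¬ Q x γ}
      rw [this]
      exact MeasurableSet.iInter fun γ => (hQm γ).compl)
  refine ⟨fun x => g (Nat.find (hQ' x)), fun γ => hfind (MeasurableSet.of_discrete (s := g ⁻¹' {γ})),
    (F ∪ {g 0}).finite_toSet.subset ?_, fun x hx => ?_⟩
  · rintro _ ⟨x, rfl⟩
    rcases Nat.find_spec (hQ' x) with h | h
    · exact Finset.mem_coe.2 (Finset.mem_union_left _ h.1)
    · have : Nat.find (hQ' x) = 0 := (Nat.find_eq_zero _).2 (Or.inr h)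
      simp [this]
  · rcases Nat.find_spec (hQ' x) with h | h
    · exact h
    · obtain ⟨γ, hγ, hxγ⟩ := hx
      obtain ⟨γ', hγ', hmin⟩ := (F.filter fun γ => γ • x ∈ B).exists_min_image
        (fun γ => φ (γ • x)) ⟨γ, Finset.mem_filter.2 ⟨hγ, hxγ⟩⟩
      rw [Finset.mem_filter] at hγ'
      exact (h γ' ⟨hγ'.1, hγ'.2, fun δ hδ hxδ => hmin δ (Finset.mem_filter.2 ⟨hδ, hxδ⟩)⟩).elim

/-- Almost every orbit of an essentially free measure preserving action of a subgroup of `ℤ ^ d` is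
cut into finite tiles in such a way that `x` and `δ • x` rarely lie in different tiles: the element
`a x` moves `x` to the base point of its tile, and `a (δ • x) * δ = a x` says that `x` and `δ • x`
have the same base point. -/
theorem exists_almost_equivariant {Γ X : Type*} [Group Γ] {d : ℕ} {ψ : Γ → Fin d → ℤ}
    (hψ : ∀ γ δ, ψ (γ * δ) = ψ γ + ψ δ) (hinj : Function.Injective ψ)
    [MeasurableSpace X] [StandardBorelSpace X] (μ : Measure X) [IsProbabilityMeasure μ]
    [MulAction Γ X] [MeasurableConstSMul Γ X]
    (hfree : ∀ᵐ x ∂μ, ∀ γ : Γ, γ • x = x → γ = 1) (S : Finset Γ) {ε : ℝ} (hε : 0 < ε) :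
    ∃ a : X → Γ, (∀ γ, MeasurableSet {x | a x = γ}) ∧ (Set.range a).Finite ∧
      ∀ δ ∈ S, μ.real {x | a (δ • x) * δ ≠ a x} ≤ ε := by
  classical
  have : Countable Γ := hinj.countable
  have hsmul : ∀ γ : Γ, Measurable fun x : X => γ • x := fun γ => measurable_const_smul γ
  let m : ℕ := S.sup (latticeLength ψ)
  let C : ℝ := 7 ^ d * (2 * m + 1)
  obtain ⟨R, hR⟩ := exists_nat_ge (max (m + 1 : ℝ) (C / ε))
  have hmR : m + 1 ≤ R := by exact_mod_cast (le_max_left _ _).trans hR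
  have hR0 : (0 : ℝ) < R := by exact_mod_cast (show 0 < R by omega)
  have hCR : C / R ≤ ε := by
    have := (le_max_right _ _).trans hR
    rw [div_le_iff₀ hε] at this
    rw [div_le_iff₀ hR0]
    linarith
  let ball : ℕ → Finset Γ := fun r => (finite_latticeLength_le hinj r).toFinset
  have hball : ∀ r γ, γ ∈ ball r ↔ latticeLength ψ γ ≤ r := fun r γ => by simp [ball]
  -- the base points of the tiles are among the points of an `R`-separated and `R`-dense set `B`
  obtain ⟨B, hB, hBsep, hBcov⟩ := exists_measurableSet_marker (X := X) ((ball R).erase 1)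
    (by simp) (fun γ hγ => by
      rw [Finset.mem_erase, hball] at hγ ⊢
      exact ⟨inv_ne_one.2 hγ.1, by rw [latticeLength_inv hψ]; exact hγ.2⟩)
  -- the points that are close to the sphere of radius `r` around some point of `B`
  let bad : ℕ → Set X := fun r => ⋃ γ ∈ (ball (3 * R)).filter fun γ =>
    r ≤ latticeLength ψ γ + m ∧ latticeLength ψ γ ≤ r + m, {x | γ • x ∈ B}
  have hbadm : ∀ r, MeasurableSet (bad r) := fun r =>
    Finset.measurableSet_biUnion _ fun γ _ => hsmul γ hB
  -- every point is bad for a bounded number of radii only, independently of `R`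
  have hcount : ∀ x, ∑ r ∈ Finset.Ico R (2 * R), (bad r).indicator (fun _ => (1 : ℝ)) x ≤ C := by
    intro x
    let T := (ball (3 * R)).filter fun γ => γ • x ∈ B
    have hT : T.card ≤ 7 ^ d := by
      refine card_le_of_separated hψ (R := R) (by omega) T (fun γ hγ => ?_)
        fun γ hγ δ hδ h => ?_
      · exact (hball _ _).1 (Finset.mem_filter.1 hγ).1
      · by_contra hne
        refine hBsep (δ • x) (Finset.mem_filter.1 hδ).2 (γ * δ⁻¹) ?_ ?_
        · rw [Finset.mem_erase, hball]
          exact ⟨fun h1 => hne (mul_inv_eq_one.1 h1), h⟩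
        · rw [smul_smul, inv_mul_cancel_right]
          exact (Finset.mem_filter.1 hγ).2
    have hsub : (Finset.Ico R (2 * R)).filter (fun r => x ∈ bad r) ⊆
        T.biUnion fun γ => Finset.Icc (latticeLength ψ γ - m) (latticeLength ψ γ + m) := by
      intro r hr
      obtain ⟨γ, hγ, hγx⟩ := Set.mem_iUnion₂.1 (Finset.mem_filter.1 hr).2
      rw [Finset.mem_filter] at hγ
      refine Finset.mem_biUnion.2 ⟨γ, Finset.mem_filter.2 ⟨hγ.1, hγx⟩, ?_⟩
      rw [Finset.mem_Icc]
      omega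
    have hcard := (Finset.card_le_card hsub).trans (Finset.card_biUnion_le_card_mul _ _ (2 * m + 1)
      fun γ _ => by rw [Nat.card_Icc]; omega)
    have hcard' : ((Finset.Ico R (2 * R)).filter (fun r => x ∈ bad r)).card ≤
        7 ^ d * (2 * m + 1) := hcard.trans (Nat.mul_le_mul_right _ hT)
    calc ∑ r ∈ Finset.Ico R (2 * R), (bad r).indicator (fun _ => (1 : ℝ)) x
        = (((Finset.Ico R (2 * R)).filter (fun r => x ∈ bad r)).card : ℝ) := by
          simp [Set.indicator_apply, Finset.sum_boole]
      _ ≤ C := by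
          simp only [C]
          exact_mod_cast hcard'
  obtain ⟨r, hr, hrμ⟩ : ∃ r ∈ Finset.Ico R (2 * R), μ.real (bad r) ≤ C / R := by
    refine Finset.exists_le_of_sum_le (Finset.nonempty_Ico.2 (by omega)) ?_
    have hi : ∀ r ∈ Finset.Ico R (2 * R),
        Integrable ((bad r).indicator fun _ => (1 : ℝ)) μ := fun r _ =>
      (integrable_const _).indicator (hbadm r)
    calc ∑ r ∈ Finset.Ico R (2 * R), μ.real (bad r)
        = ∫ x, ∑ r ∈ Finset.Ico R (2 * R), (bad r).indicator (fun _ => (1 : ℝ)) x ∂μ := by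
          rw [integral_finsetSum _ hi]
          exact Finset.sum_congr rfl fun r _ => (integral_indicator_one (hbadm r)).symm
      _ ≤ ∫ _, C ∂μ := integral_mono (integrable_finsetSum _ hi) (integrable_const _) hcount
      _ = ∑ r ∈ Finset.Ico R (2 * R), C / R := by
          rw [integral_const, Finset.sum_const, Nat.card_Ico, show 2 * R - R = R by omega]
          simp only [probReal_univ, one_smul, nsmul_eq_mul]
          field_simp
  rw [Finset.mem_Ico] at hr
  have hφ := measurableEmbedding_embeddingReal X
  -- a point joins the tile of the first point of `B`, in a linear order on `X`, among those at
  -- distance at most `r`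
  obtain ⟨a, ham, hafin, ha⟩ := exists_measurable_argmin hB hφ.measurable (ball r)
  refine ⟨a, ham, hafin, fun δ hδ => (ENNReal.toReal_mono
    (measure_ne_top μ _) (measure_mono_ae ?_)).trans (hrμ.trans hCR)⟩
  filter_upwards [hfree] with x hx hxδ
  by_contra hxbad
  refine hxδ ?_
  have hδm : latticeLength ψ δ ≤ m := Finset.le_sup hδ
  have hiff : ∀ γ, γ • x ∈ B → (γ ∈ ball r ↔ γ * δ⁻¹ ∈ ball r) := by
    intro γ hγ
    have h1 := latticeLength_mul_le hψ γ δ⁻¹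
    have h2 := latticeLength_mul_le hψ (γ * δ⁻¹) δ
    rw [latticeLength_inv hψ] at h1
    rw [inv_mul_cancel_right] at h2
    rw [hball, hball]
    by_contra hne
    refine hxbad (Set.mem_iUnion₂.2 ⟨γ, Finset.mem_filter.2 ⟨(hball _ _).2 ?_, ?_, ?_⟩, hγ⟩) <;>
      omega
  obtain ⟨γ, hγ, hγB⟩ : ∃ γ ∈ ball r, γ • x ∈ B := by
    rcases hBcov x hx with h | ⟨γ, hγ, h⟩
    · refine ⟨1, ?_, by rwa [one_smul]⟩
      rw [hball, latticeLength_le_iff]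
      have h1 : ψ 1 = 0 := by simpa using hψ 1 1
      simp [h1]
    · exact ⟨γ, (hball _ _).2 (((hball _ _).1 (Finset.mem_of_mem_erase hγ)).trans hr.1), h⟩
  obtain ⟨h1, h2, h3⟩ := ha x ⟨γ, hγ, hγB⟩
  obtain ⟨h4, h5, h6⟩ := ha (δ • x) ⟨a x * δ⁻¹, (hiff _ h2).1 h1, by
    rwa [smul_smul, inv_mul_cancel_right]⟩
  rw [smul_smul] at h5 h6
  have h7 := h3 _ ((hiff _ h5).2 (by rwa [mul_inv_cancel_right])) h5
  have h8 := h6 _ ((hiff _ h2).1 h1) (by rwa [smul_smul, inv_mul_cancel_right])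
  rw [smul_smul, inv_mul_cancel_right] at h8
  have h9 := hφ.injective (le_antisymm h7 h8)
  have := hx ((a x)⁻¹ * (a (δ • x) * δ)) (by rw [mul_smul, ← h9, inv_smul_smul])
  exact (inv_mul_eq_one.1 this).symm

/-! ### Cones over singular simplices -/

theorem stdSimplex_map_succAbove_self {n : ℕ} (i : Fin (n + 2)) (x : stdSimplex ℝ (Fin (n + 1))) :
    stdSimplex.map i.succAbove x i = 0 := by
  rw [stdSimplex.map_coe, FunOnFinite.linearMap_apply_apply]
  refine Finset.sum_eq_zero fun j hj => ?_
  exact ((Fin.succAbove_ne i j) (Finset.mem_filter.1 hj).2).elim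

theorem stdSimplex_map_succAbove_succAbove {n : ℕ} (i : Fin (n + 2))
    (x : stdSimplex ℝ (Fin (n + 1))) (k : Fin (n + 1)) :
    stdSimplex.map i.succAbove x (i.succAbove k) = x k := by
  rw [stdSimplex.map_coe, FunOnFinite.linearMap_apply_apply]
  simp [Finset.filter_eq']

/-- The projection from the vertex `0` of a simplex to the opposite face, with an arbitrary value
at the vertex itself. -/
def oppositeProj {n : ℕ} (t : stdSimplex ℝ (Fin (n + 2))) : stdSimplex ℝ (Fin (n + 1)) :=
  if h : t 0 < 1 then
    ⟨fun i => t i.succ / (1 - t 0),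
      fun i => div_nonneg (stdSimplex.zero_le t _) (sub_nonneg.2 h.le), by
        have h1 := stdSimplex.sum_eq_one t
        rw [Fin.sum_univ_succ] at h1
        rw [← Finset.sum_div, div_eq_one_iff_eq (by linarith)]
        linarith⟩
  else stdSimplex.vertex 0

theorem oppositeProj_apply {n : ℕ} {t : stdSimplex ℝ (Fin (n + 2))} (h : t 0 < 1)
    (i : Fin (n + 1)) : oppositeProj t i = t i.succ / (1 - t 0) := by
  rw [oppositeProj, dif_pos h]
  rfl

theorem continuous_stdSimplex_apply {n : ℕ} (i : Fin (n + 1)) :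
    Continuous fun t : stdSimplex ℝ (Fin (n + 1)) => t i :=
  (continuous_apply i).comp continuous_subtype_val

theorem continuousAt_oppositeProj {n : ℕ} {t : stdSimplex ℝ (Fin (n + 2))} (h : t 0 < 1) :
    ContinuousAt oppositeProj t := by
  rw [Topology.IsInducing.subtypeVal.continuousAt_iff]
  have hev : ∀ᶠ s : stdSimplex ℝ (Fin (n + 2)) in nhds t, s 0 < 1 :=
    (continuous_stdSimplex_apply 0).continuousAt.eventually_lt_const h
  have hc : ContinuousAt (fun (s : stdSimplex ℝ (Fin (n + 2))) (i : Fin (n + 1)) =>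
      s i.succ / (1 - s 0)) t :=
    continuousAt_pi.2 fun i => (continuous_stdSimplex_apply i.succ).continuousAt.div
      (continuousAt_const.sub (continuous_stdSimplex_apply 0).continuousAt) (by linarith)
  refine hc.congr ?_
  filter_upwards [hev] with s hs
  funext i
  exact (oppositeProj_apply hs i).symm

section Cone

variable {E V : Type*} [TopologicalSpace E] [NormedAddCommGroup V] [NormedSpace ℝ V] (h : E ≃ₜ V)

theorem continuous_coneMap {n : ℕ} (σ : Simp E n) :
    Continuous fun t : stdSimplex ℝ (Fin (n + 2)) => (1 - t 0) • h (σ (oppositeProj t)) := by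
  have hσ : Continuous fun x => h (σ x) := h.continuous.comp σ.continuous
  obtain ⟨C, hC⟩ := isCompact_univ.exists_bound_of_continuousOn hσ.continuousOn
  refine continuous_iff_continuousAt.2 fun t => ?_
  have ht0 : ContinuousAt (fun t : stdSimplex ℝ (Fin (n + 2)) => 1 - t 0) t :=
    continuousAt_const.sub (continuous_stdSimplex_apply 0).continuousAt
  rcases (stdSimplex.le_one t 0).lt_or_eq with ht | ht
  · exact ht0.smul (hσ.continuousAt.comp (continuousAt_oppositeProj ht))
  · -- near the cone point, the image of `σ` is scaled down to a neighbourhood of the origin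
    rw [ContinuousAt, ht, sub_self, zero_smul]
    refine squeeze_zero_norm (a := fun s : stdSimplex ℝ (Fin (n + 2)) => (1 - s 0) * C)
      (fun s => ?_) ?_
    · rw [norm_smul, Real.norm_of_nonneg (sub_nonneg.2 (stdSimplex.le_one s 0))]
      exact mul_le_mul_of_nonneg_left (hC _ (Set.mem_univ _))
        (sub_nonneg.2 (stdSimplex.le_one s 0))
    · have := ht0.tendsto.mul_const C
      rwa [ht, sub_self, zero_mul] at this

/-- The cone over a singular simplex of a space that is homeomorphic to a normed space: the vertex
`0` is sent to the point with image `0`, and segments from this vertex to the opposite face are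
sent to straight segments. -/
def coneSimplex {n : ℕ} (σ : Simp E n) : Simp E (n + 1) :=
  ⟨fun t => h.symm ((1 - t 0) • h (σ (oppositeProj t))),
    h.symm.continuous.comp (continuous_coneMap h σ)⟩

theorem face_zero_coneSimplex {n : ℕ} (σ : Simp E n) : face 0 (coneSimplex h σ) = σ := by
  ext x
  have h0 := stdSimplex_map_succAbove_self 0 x
  have hx : oppositeProj (stdSimplex.map (0 : Fin (n + 2)).succAbove x) = x := by
    ext i
    rw [oppositeProj_apply (by rw [h0]; exact one_pos), h0, sub_zero, div_one]
    exact stdSimplex_map_succAbove_succAbove 0 x i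
  change h.symm ((1 - stdSimplex.map (0 : Fin (n + 2)).succAbove x 0) •
    h (σ (oppositeProj (stdSimplex.map (0 : Fin (n + 2)).succAbove x)))) = σ x
  rw [h0, hx, sub_zero, one_smul, h.symm_apply_apply]

theorem face_succ_coneSimplex {n : ℕ} (σ : Simp E (n + 1)) (i : Fin (n + 2)) :
    face i.succ (coneSimplex h σ) = coneSimplex h (face i σ) := by
  ext x
  have h0 : stdSimplex.map i.succ.succAbove x 0 = x 0 := by
    simpa using stdSimplex_map_succAbove_succAbove i.succ x 0
  change h.symm ((1 - stdSimplex.map i.succ.succAbove x 0) •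
    h (σ (oppositeProj (stdSimplex.map i.succ.succAbove x)))) =
      h.symm ((1 - x 0) • h (σ (stdSimplex.map i.succAbove (oppositeProj x))))
  rw [h0]
  rcases (stdSimplex.le_one x 0).lt_or_eq with hx | hx
  · have key : oppositeProj (stdSimplex.map i.succ.succAbove x) =
        stdSimplex.map i.succAbove (oppositeProj x) := by
      ext j
      rw [oppositeProj_apply (by rwa [h0]), h0]
      rcases Fin.eq_self_or_eq_succAbove i j with rfl | ⟨k, rfl⟩
      · rw [stdSimplex_map_succAbove_self, stdSimplex_map_succAbove_self, zero_div]
      · rw [stdSimplex_map_succAbove_succAbove, ← Fin.succ_succAbove_succ,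
          stdSimplex_map_succAbove_succAbove, oppositeProj_apply hx]
    rw [key]
  · rw [hx, sub_self, zero_smul, zero_smul]

theorem face_one_coneSimplex (σ : Simp E 0) :
    face 1 (coneSimplex h σ) = ContinuousMap.const _ (h.symm 0) := by
  ext x
  have h0 : stdSimplex.map (1 : Fin 2).succAbove x 0 = 1 := by
    have := stdSimplex_map_succAbove_succAbove (1 : Fin 2) x 0
    have hx : x 0 = 1 := (Fin.sum_univ_one _).symm.trans (stdSimplex.sum_eq_one x)
    rw [hx] at this
    simpa using this
  change h.symm ((1 - stdSimplex.map (1 : Fin 2).succAbove x 0) • _) = h.symm 0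
  rw [h0, sub_self, zero_smul]

end Cone

/-! ### The group of bounded integral functions -/

section LInftyZ

variable {X : Type*} [MeasurableSpace X] {μ : Measure X}

theorem norm1_eq_integral_norm (f : LInftyZ μ) : norm1 f = ∫ x, ‖toLp f x‖ ∂μ := by
  simp only [norm1, Int.norm_eq_abs]

theorem norm1_nonneg (f : LInftyZ μ) : 0 ≤ norm1 f :=
  integral_nonneg fun _ => abs_nonneg _

theorem integrable_toLp [IsFiniteMeasure μ] (f : LInftyZ μ) : Integrable (toLp f) μ :=
  (Lp.memLp (toLp f)).integrable le_top

theorem norm1_add_le [IsFiniteMeasure μ] (f g : LInftyZ μ) :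
    norm1 (f + g) ≤ norm1 f + norm1 g := by
  simp only [norm1_eq_integral_norm]
  rw [← integral_add (integrable_toLp f).norm (integrable_toLp g).norm]
  refine integral_mono_ae (integrable_toLp _).norm
    ((integrable_toLp f).norm.add (integrable_toLp g).norm) ?_
  filter_upwards [Lp.coeFn_add (toLp f) (toLp g)] with x hx
  rw [map_add, hx]
  exact norm_add_le _ _

theorem eq_zero_of_norm1_eq_zero [IsFiniteMeasure μ] {f : LInftyZ μ} (hf : norm1 f = 0) :
    f = 0 := by
  rw [norm1_eq_integral_norm, integral_eq_zero_iff_of_nonneg (fun _ => norm_nonneg _)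
    (integrable_toLp f).norm] at hf
  refine toLp.injective ?_
  rw [map_zero]
  refine Lp.ext ?_
  filter_upwards [hf, Lp.coeFn_zero ℤ ∞ μ] with x hx h0
  rw [h0]
  exact norm_eq_zero.1 hx

/-- Multiplication of an element of the Lebesgue space by the indicator function of a measurable
set. -/
def indicatorLp {A : Set X} (hA : MeasurableSet A) (f : Lp ℤ ∞ μ) : Lp ℤ ∞ μ :=
  MemLp.toLp (A.indicator f) ((Lp.memLp f).indicator hA)

theorem indicatorLp_ae_eq {A : Set X} (hA : MeasurableSet A) (f : Lp ℤ ∞ μ) :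
    (indicatorLp hA f : X → ℤ) =ᵐ[μ] A.indicator f :=
  MemLp.coeFn_toLp _

theorem indicatorLp_add {A : Set X} (hA : MeasurableSet A) (f g : Lp ℤ ∞ μ) :
    indicatorLp hA (f + g) = indicatorLp hA f + indicatorLp hA g := by
  refine Lp.ext ?_
  filter_upwards [indicatorLp_ae_eq hA f, indicatorLp_ae_eq hA g, indicatorLp_ae_eq hA (f + g),
    Lp.coeFn_add f g, Lp.coeFn_add (indicatorLp hA f) (indicatorLp hA g)] with x h1 h2 h3 h4 h5
  rw [h5, Pi.add_apply, h1, h2, h3]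
  by_cases h : x ∈ A
  · rw [Set.indicator_of_mem h, Set.indicator_of_mem h, Set.indicator_of_mem h, h4, Pi.add_apply]
  · rw [Set.indicator_of_notMem h, Set.indicator_of_notMem h, Set.indicator_of_notMem h, add_zero]

/-- Restriction of an element of `L^∞(X, μ; ℤ)` to a measurable set, extended by zero. -/
def restrictTo {A : Set X} (hA : MeasurableSet A) : LInftyZ μ →+ LInftyZ μ :=
  AddMonoidHom.mk' (fun f => toLp.symm (indicatorLp hA (toLp f))) fun f g =>
    congrArg toLp.symm (indicatorLp_add hA (toLp f) (toLp g))

theorem restrictTo_ae_eq {A : Set X} (hA : MeasurableSet A) (f : LInftyZ μ) :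
    (toLp (restrictTo hA f) : X → ℤ) =ᵐ[μ] A.indicator (toLp f) :=
  indicatorLp_ae_eq hA (toLp f)

theorem restrictTo_eq_zero {A : Set X} (hA : MeasurableSet A) (f : LInftyZ μ) (h : A = ∅) :
    restrictTo hA f = 0 := by
  refine toLp.injective (Lp.ext ?_)
  rw [map_zero]
  filter_upwards [restrictTo_ae_eq hA f, Lp.coeFn_zero ℤ ∞ μ] with x hx h0
  rw [hx, h0]
  simp [h]

theorem toLp_sum_ae_eq {ι : Type*} (s : Finset ι) (F : ι → LInftyZ μ) :
    (toLp (∑ i ∈ s, F i) : X → ℤ) =ᵐ[μ] fun x => ∑ i ∈ s, toLp (F i) x := by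
  classical
  induction s using Finset.induction_on with
  | empty =>
    rw [Finset.sum_empty, map_zero]
    filter_upwards [Lp.coeFn_zero ℤ ∞ μ] with x hx
    rw [hx, Finset.sum_empty]
    rfl
  | insert i s hi ih =>
    rw [Finset.sum_insert hi, map_add]
    filter_upwards [Lp.coeFn_add (toLp (F i)) (toLp (∑ i ∈ s, F i)), ih] with x hx hs
    rw [hx, Pi.add_apply, hs, Finset.sum_insert hi]

section Fibers

variable {Γ : Type*} {a : X → Γ} (ha : ∀ γ, MeasurableSet {x | a x = γ}) {Φ : Finset Γ}

theorem sum_restrictTo_fiber (hΦ : ∀ x, a x ∈ Φ) (f : LInftyZ μ) :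
    ∑ γ ∈ Φ, restrictTo (ha γ) f = f := by
  classical
  refine toLp.injective (Lp.ext ?_)
  have h : ∀ᵐ x ∂μ, ∀ γ ∈ Φ,
      toLp (restrictTo (ha γ) f) x = {x | a x = γ}.indicator (toLp f) x :=
    (Finset.eventually_all Φ).2 fun γ _ => restrictTo_ae_eq (ha γ) f
  filter_upwards [toLp_sum_ae_eq Φ fun γ => restrictTo (ha γ) f, h] with x hx h
  rw [hx, Finset.sum_congr rfl h]
  simp [Set.indicator_apply, hΦ x]

theorem sum_norm1_restrictTo_fiber_le [IsFiniteMeasure μ] (f : LInftyZ μ) :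
    ∑ γ ∈ Φ, norm1 (restrictTo (ha γ) f) ≤ norm1 f := by
  classical
  simp only [norm1_eq_integral_norm]
  rw [← integral_finsetSum _ fun γ _ => (integrable_toLp _).norm]
  refine integral_mono_ae (integrable_finsetSum _ fun γ _ => (integrable_toLp _).norm)
    (integrable_toLp f).norm ?_
  have h : ∀ᵐ x ∂μ, ∀ γ ∈ Φ,
      toLp (restrictTo (ha γ) f) x = {x | a x = γ}.indicator (toLp f) x :=
    (Finset.eventually_all Φ).2 fun γ _ => restrictTo_ae_eq (ha γ) f
  filter_upwards [h] with x h
  rw [Finset.sum_congr rfl fun γ hγ => congrArg norm (h γ hγ)]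
  simp only [Set.indicator_apply, Set.mem_ofPred_eq, apply_ite norm, norm_zero, Finset.sum_ite_eq]
  split_ifs
  exacts [le_rfl, norm_nonneg _]

/-- Two partitions into fibres that agree outside of a set of small measure cut a bounded function
into almost the same pieces. -/
theorem exists_sum_norm1_restrictTo_fiber_sub_le (Γ : Type*) [IsFiniteMeasure μ] (f : LInftyZ μ) :
    ∃ C : ℝ, 0 ≤ C ∧ ∀ (a b : X → Γ) (ha : ∀ γ, MeasurableSet {x | a x = γ})
      (hb : ∀ γ, MeasurableSet {x | b x = γ}) (Φ : Finset Γ), (∀ x, a x ∈ Φ) →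
      ∑ γ ∈ Φ, norm1 (restrictTo (ha γ) f - restrictTo (hb γ) f) ≤
        C * μ.real {x | a x ≠ b x} := by
  classical
  obtain ⟨C, hC⟩ : ∃ C : ℝ, ∀ᵐ x ∂μ, ‖toLp f x‖ ≤ C := by
    refine ⟨(eLpNormEssSup (toLp f) μ).toReal, ?_⟩
    filter_upwards [ae_le_eLpNormEssSup (f := toLp f) (μ := μ)] with x hx
    have hfin : eLpNormEssSup (toLp f) μ ≠ ∞ := by
      rw [← eLpNorm_exponent_top]
      exact (Lp.memLp (toLp f)).eLpNorm_ne_top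
    simpa using ENNReal.toReal_mono hfin hx
  refine ⟨2 * max C 0, by positivity, fun a b ha hb Φ hΦ => ?_⟩
  have hab : MeasurableSet {x | a x ≠ b x} := by
    have : {x | a x = b x} = ⋃ γ ∈ Φ, {x | a x = γ} ∩ {x | b x = γ} := by
      ext x
      simp only [Set.mem_ofPred_eq, Set.mem_iUnion, Set.mem_inter_iff, exists_prop]
      exact ⟨fun h => ⟨a x, hΦ x, rfl, h.symm⟩, fun ⟨γ, _, h1, h2⟩ => h1.trans h2.symm⟩
    refine MeasurableSet.compl (s := {x | a x = b x}) ?_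
    rw [this]
    exact Finset.measurableSet_biUnion _ fun γ _ => (ha γ).inter (hb γ)
  simp only [norm1_eq_integral_norm]
  rw [← integral_finsetSum _ fun γ _ => (integrable_toLp _).norm, mul_comm, ← smul_eq_mul,
    ← integral_indicator_const _ hab]
  refine integral_mono_ae (integrable_finsetSum _ fun γ _ => (integrable_toLp _).norm)
    ((integrable_const _).indicator hab) ?_
  have h : ∀ᵐ x ∂μ, ∀ γ ∈ Φ, toLp (restrictTo (ha γ) f - restrictTo (hb γ) f) x =
      {x | a x = γ}.indicator (toLp f) x - {x | b x = γ}.indicator (toLp f) x := by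
    refine (Finset.eventually_all Φ).2 fun γ _ => ?_
    filter_upwards [restrictTo_ae_eq (ha γ) f, restrictTo_ae_eq (hb γ) f,
      Lp.coeFn_sub (toLp (restrictTo (ha γ) f)) (toLp (restrictTo (hb γ) f))] with x h1 h2 h3
    rw [map_sub, h3, Pi.sub_apply, h1, h2]
  filter_upwards [h, hC] with x h hC
  rw [Finset.sum_congr rfl fun γ hγ => congrArg norm (h γ hγ)]
  by_cases hx : a x = b x
  · simp [Set.indicator_apply, hx]
  · have hle : ∀ c : Γ, ∑ γ ∈ Φ, ‖if c = γ then toLp f x else 0‖ ≤ max C 0 := by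
      intro c
      simp only [apply_ite norm, norm_zero, Finset.sum_ite_eq]
      split_ifs
      exacts [hC.trans (le_max_left _ _), le_max_right _ _]
    rw [Set.indicator_of_mem (show x ∈ {x | a x ≠ b x} from hx), two_mul]
    simp only [Set.indicator_apply, Set.mem_ofPred_eq]
    exact (Finset.sum_le_sum fun γ _ => norm_sub_le _ _).trans
      (Finset.sum_add_distrib.le.trans (add_le_add (hle _) (hle _)))

end Fibers

variable {Γ : Type*} [Group Γ] [MulAction Γ X] [MeasurableConstSMul Γ X]
  [SMulInvariantMeasure Γ X μ]

theorem rightMul_add (f g : LInftyZ μ) (γ : Γ) :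
    rightMul (f + g) γ = rightMul f γ + rightMul g γ :=
  congrArg toLp.symm (smul_add (DomMulAct.mk γ) (toLp f) (toLp g))

/-- The right action of a group element on `L^∞(X, μ; ℤ)`, as a homomorphism. -/
def rightMulHom (γ : Γ) : LInftyZ μ →+ LInftyZ μ :=
  AddMonoidHom.mk' (fun f => rightMul f γ) fun f g => rightMul_add f g γ

theorem rightMul_one (f : LInftyZ μ) : rightMul f (1 : Γ) = f :=
  congrArg toLp.symm (one_smul _ (toLp f))

theorem rightMul_restrictTo {A : Set X} (hA : MeasurableSet A) (γ : Γ)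
    (hA' : MeasurableSet {x | γ • x ∈ A}) (f : LInftyZ μ) :
    rightMul (restrictTo hA f) γ = restrictTo hA' (rightMul f γ) := by
  refine toLp.injective (Lp.ext ?_)
  filter_upwards [rightMul_ae_eq (restrictTo hA f) γ, restrictTo_ae_eq hA' (rightMul f γ),
    rightMul_ae_eq f γ,
    (measurePreserving_smul γ μ).quasiMeasurePreserving.ae (restrictTo_ae_eq hA f)] with x h1 h2 h3 h4
  rw [h1, h2, h4]
  by_cases h : γ • x ∈ A
  · rw [Set.indicator_of_mem h, Set.indicator_of_mem (show x ∈ {x | γ • x ∈ A} from h), h3]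
  · rw [Set.indicator_of_notMem h, Set.indicator_of_notMem (show x ∉ {x | γ • x ∈ A} from h)]

end LInftyZ

/-! ### Chains before passing to coinvariants -/

/-- The group `L^∞(X, μ; ℤ) ⊗_ℤ C_n(E; ℤ)`, as finitely supported families of functions that are
indexed by the singular simplices of `E`. The parametrised chain group is a quotient of it. -/
abbrev FreeChain {X : Type*} [MeasurableSpace X] (μ : Measure X) (E : Type*) [TopologicalSpace E]
    (n : ℕ) : Type _ := Simp E n →₀ LInftyZ μ

section FreeChain

variable {X : Type*} [MeasurableSpace X] {μ : Measure X} {E : Type*} [TopologicalSpace E]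

/-- The boundary operator `f ⊗ σ ↦ ∑ i, (-1) ^ i • f ⊗ ∂ᵢ σ`. -/
def freeBoundary (n : ℕ) : FreeChain μ E (n + 1) →+ FreeChain μ E n :=
  Finsupp.liftAddHom fun σ =>
    ∑ i : Fin (n + 2), (-1 : ℤ) ^ (i : ℕ) • Finsupp.singleAddHom (face i σ)

theorem freeBoundary_single (n : ℕ) (σ : Simp E (n + 1)) (f : LInftyZ μ) :
    freeBoundary n (Finsupp.single σ f) =
      ∑ i : Fin (n + 2), (-1 : ℤ) ^ (i : ℕ) • Finsupp.single (face i σ) f := by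
  simp [freeBoundary, AddMonoidHom.finsetSum_apply]

/-- The homomorphism `c ↦ f ⊗ c`. -/
def freeTmul (f : LInftyZ μ) (n : ℕ) : SingChain E n →+ FreeChain μ E n :=
  Finsupp.mapRange.addMonoidHom (zmultiplesHom (LInftyZ μ) f)

theorem freeTmul_single (f : LInftyZ μ) {n : ℕ} (σ : Simp E n) :
    freeTmul f n (Finsupp.single σ 1) = Finsupp.single σ f := by
  simp [freeTmul]

theorem freeBoundary_freeTmul (f : LInftyZ μ) (n : ℕ) (c : SingChain E (n + 1)) :
    freeBoundary n (freeTmul f (n + 1) c) = freeTmul f n (singBoundary E n c) := by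
  have : (freeBoundary n).comp (freeTmul f (n + 1)) =
      (freeTmul f n).comp (singBoundary E n).toAddMonoidHom := by
    refine Finsupp.addHom_ext' fun σ => AddMonoidHom.ext_int ?_
    change freeBoundary n (freeTmul f (n + 1) (Finsupp.single σ 1)) =
      freeTmul f n (singBoundary E n (Finsupp.single σ 1))
    rw [freeTmul_single, freeBoundary_single, singBoundary_single, map_sum]
    exact Finset.sum_congr rfl fun i _ => by rw [map_zsmul, freeTmul_single]
  exact DFunLike.congr_fun this c

theorem freeBoundary_freeBoundary (n : ℕ) (w : FreeChain μ E (n + 2)) :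
    freeBoundary n (freeBoundary (n + 1) w) = 0 := by
  induction w using Finsupp.induction_linear with
  | zero => simp
  | add x y hx hy => rw [map_add, map_add, hx, hy, add_zero]
  | single σ f =>
    rw [← freeTmul_single, freeBoundary_freeTmul, freeBoundary_freeTmul,
      singBoundary_singBoundary, map_zero]

/-- The `ℓ¹`-norm `∑ f_σ ⊗ σ ↦ ∑ |f_σ|`. -/
def freeNorm {n : ℕ} (w : FreeChain μ E n) : ℝ :=
  w.sum fun _ f => norm1 f

theorem freeNorm_single {n : ℕ} (σ : Simp E n) (f : LInftyZ μ) :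
    freeNorm (Finsupp.single σ f) = norm1 f :=
  Finsupp.sum_single_index (norm1_zero μ)

theorem freeNorm_add_le [IsFiniteMeasure μ] {n : ℕ} (v w : FreeChain μ E n) :
    freeNorm (v + w) ≤ freeNorm v + freeNorm w := by
  classical
  have h : ∀ u : FreeChain μ E n, u.support ⊆ v.support ∪ w.support →
      freeNorm u = ∑ σ ∈ v.support ∪ w.support, norm1 (u σ) := fun u hu =>
    Finsupp.sum_of_support_subset _ hu _ fun _ _ => norm1_zero μ
  rw [h _ Finsupp.support_add, h v Finset.subset_union_left, h w Finset.subset_union_right,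
    ← Finset.sum_add_distrib]
  exact Finset.sum_le_sum fun σ _ => norm1_add_le _ _

theorem freeNorm_sum_le [IsFiniteMeasure μ] {n : ℕ} {ι : Type*} (s : Finset ι)
    (w : ι → FreeChain μ E n) : freeNorm (∑ i ∈ s, w i) ≤ ∑ i ∈ s, freeNorm (w i) :=
  Finset.le_sum_of_subadditive _ (by simp [freeNorm]) freeNorm_add_le s w

theorem freeNorm_map_le [IsFiniteMeasure μ] {m n : ℕ} (F : FreeChain μ E m →+ FreeChain μ E n)
    (hF : ∀ σ f, freeNorm (F (Finsupp.single σ f)) ≤ norm1 f) (w : FreeChain μ E m) :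
    freeNorm (F w) ≤ freeNorm w := by
  conv_lhs => rw [← Finsupp.sum_single w, Finsupp.sum, map_sum]
  exact (freeNorm_sum_le _ _).trans (Finset.sum_le_sum fun σ _ => hF σ _)

/-! ### The cone operator -/

section Cone

variable {V : Type*} [NormedAddCommGroup V] [NormedSpace ℝ V] (h : E ≃ₜ V)

/-- The cone operator `f ⊗ σ ↦ f ⊗ cone σ`. -/
def coneChain (n : ℕ) : FreeChain μ E n →+ FreeChain μ E (n + 1) :=
  Finsupp.mapDomain.addMonoidHom (coneSimplex h)

theorem coneChain_single {n : ℕ} (σ : Simp E n) (f : LInftyZ μ) :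
    coneChain h n (Finsupp.single σ f) = Finsupp.single (coneSimplex h σ) f :=
  Finsupp.mapDomain_single

theorem freeNorm_coneChain_le [IsFiniteMeasure μ] {n : ℕ} (w : FreeChain μ E n) :
    freeNorm (coneChain h n w) ≤ freeNorm w :=
  freeNorm_map_le _ (fun σ f => by rw [coneChain_single, freeNorm_single]) w

theorem freeBoundary_coneChain (n : ℕ) (w : FreeChain μ E (n + 1)) :
    freeBoundary (n + 1) (coneChain h (n + 1) w) = w - coneChain h n (freeBoundary n w) := by
  induction w using Finsupp.induction_linear with
  | zero => simp
  | add x y hx hy =>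
    simp only [map_add, hx, hy]
    abel
  | single σ f =>
    rw [coneChain_single, freeBoundary_single, freeBoundary_single, Fin.sum_univ_succ,
      face_zero_coneSimplex, map_sum, sub_eq_add_neg, ← Finset.sum_neg_distrib]
    congr 1
    · simp
    · refine Finset.sum_congr rfl fun i _ => ?_
      rw [face_succ_coneSimplex, map_zsmul, coneChain_single, Fin.val_succ, pow_succ, mul_neg_one,
        neg_smul]

/-- Boundaries are filled by their cones. In degree `0` the augmentation of a boundary vanishes, so
that the cone point does not contribute. -/
theorem freeBoundary_coneChain_freeBoundary (n : ℕ) (w : FreeChain μ E (n + 1)) :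
    freeBoundary n (coneChain h n (freeBoundary n w)) = freeBoundary n w := by
  cases n with
  | succ n => rw [freeBoundary_coneChain, freeBoundary_freeBoundary, map_zero, sub_zero]
  | zero =>
    have h0 : ∀ (σ : Simp E 0) (f : LInftyZ μ),
        freeBoundary 0 (Finsupp.single (coneSimplex h σ) f) =
          Finsupp.single σ f - Finsupp.single (ContinuousMap.const _ (h.symm 0)) f := by
      intro σ f
      rw [freeBoundary_single, Fin.sum_univ_two, face_zero_coneSimplex, face_one_coneSimplex]
      simp [sub_eq_add_neg]
    induction w using Finsupp.induction_linear with
    | zero => simp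
    | add x y hx hy => simp only [map_add, hx, hy]
    | single τ f =>
      rw [freeBoundary_single, Fin.sum_univ_two]
      simp only [map_add, map_zsmul, coneChain_single, h0]
      simp [sub_eq_add_neg]
      abel

end Cone

/-! ### Moving chains along a map to the group -/

variable {Γ : Type*} [Group Γ] [MulAction Γ X] [MeasurableConstSMul Γ X]
  [SMulInvariantMeasure Γ X μ] [MulAction Γ E] [ContinuousConstSMul Γ E]

/-- The part of `f ⊗ σ` over `x` is moved by the group element `a x`. All values of `a` are supposed
to lie in the finite set `Φ`. -/
def moveChain {a : X → Γ} (ha : ∀ γ, MeasurableSet {x | a x = γ}) (Φ : Finset Γ) (n : ℕ) :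
    FreeChain μ E n →+ FreeChain μ E n :=
  Finsupp.liftAddHom fun σ => ∑ γ ∈ Φ,
    (Finsupp.singleAddHom (γ • σ)).comp ((rightMulHom γ⁻¹).comp (restrictTo (ha γ)))

section Move

variable {a : X → Γ} (ha : ∀ γ, MeasurableSet {x | a x = γ}) {Φ : Finset Γ}

theorem moveChain_single {n : ℕ} (σ : Simp E n) (f : LInftyZ μ) :
    moveChain ha Φ n (Finsupp.single σ f) =
      ∑ γ ∈ Φ, Finsupp.single (γ • σ) (rightMul (restrictTo (ha γ) f) γ⁻¹) := by
  rw [moveChain, Finsupp.liftAddHom_apply_single, AddMonoidHom.finsetSum_apply]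
  rfl

theorem freeBoundary_moveChain (n : ℕ) (w : FreeChain μ E (n + 1)) :
    freeBoundary n (moveChain ha Φ (n + 1) w) = moveChain ha Φ n (freeBoundary n w) := by
  induction w using Finsupp.induction_linear with
  | zero => simp
  | add x y hx hy => simp only [map_add, hx, hy]
  | single σ f =>
    simp only [moveChain_single, freeBoundary_single, map_sum, map_zsmul, face_smul,
      Finset.smul_sum]
    exact Finset.sum_comm

theorem freeNorm_moveChain_le [IsFiniteMeasure μ] {n : ℕ} (w : FreeChain μ E n) :
    freeNorm (moveChain ha Φ n w) ≤ freeNorm w := by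
  refine freeNorm_map_le _ (fun σ f => ?_) w
  rw [moveChain_single]
  refine (freeNorm_sum_le _ _).trans ?_
  simp only [freeNorm_single, norm1_rightMul]
  exact sum_norm1_restrictTo_fiber_le ha f

/-- The elements `f ⊗ δ • σ` and `(f · δ) ⊗ σ`, which represent the same parametrised chain, are
moved to almost the same chain if `a (δ • x) * δ = a x` for most `x`. -/
theorem exists_freeNorm_moveChain_sub_le [IsFiniteMeasure μ] {n : ℕ} (δ : Γ) (σ : Simp E n)
    (f : LInftyZ μ) : ∃ C : ℝ, 0 ≤ C ∧ ∀ (a : X → Γ) (ha : ∀ γ, MeasurableSet {x | a x = γ})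
      (Φ : Finset Γ), (∀ x, a x ∈ Φ) →
      freeNorm (moveChain ha Φ n (Finsupp.single (δ • σ) f - Finsupp.single σ (rightMul f δ))) ≤
        C * μ.real {x | a (δ • x) * δ ≠ a x} := by
  classical
  obtain ⟨C, hC0, hC⟩ := exists_sum_norm1_restrictTo_fiber_sub_le Γ (rightMul f δ)
  refine ⟨C, hC0, fun a ha Φ hΦ => ?_⟩
  let b : X → Γ := fun x => a (δ • x) * δ
  have hbeq : ∀ γ, {x | b x = γ} = {x | δ • x ∈ {x | a x = γ * δ⁻¹}} := fun γ => by
    ext x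
    exact eq_mul_inv_iff_mul_eq.symm
  have hb : ∀ γ, MeasurableSet {x | b x = γ} := fun γ => by
    rw [hbeq]
    exact measurable_const_smul δ (ha _)
  let Φδ : Finset Γ := Φ.image (· * δ)
  have h1 : moveChain ha Φ n (Finsupp.single (δ • σ) f) = ∑ γ ∈ Φ ∪ Φδ,
      Finsupp.single (γ • σ) (rightMul (restrictTo (hb γ) (rightMul f δ)) γ⁻¹) := by
    rw [← Finset.sum_subset (Finset.subset_union_right (s₁ := Φ)), Finset.sum_image
      fun _ _ _ _ h => mul_right_cancel h, moveChain_single]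
    · refine Finset.sum_congr rfl fun γ _ => ?_
      have hset : {x | b x = γ * δ} = {x | δ • x ∈ {x | a x = γ}} := by
        rw [hbeq, mul_inv_cancel_right]
      have : restrictTo (hb (γ * δ)) (rightMul f δ) = rightMul (restrictTo (ha γ) f) δ := by
        rw [rightMul_restrictTo (ha γ) δ (hset ▸ hb _)]
        congr!
      rw [this, rightMul_rightMul, mul_inv_rev, mul_inv_cancel_left, mul_smul]
    · intro γ _ hγ
      rw [restrictTo_eq_zero]
      · exact (congrArg _ ((rightMulHom γ⁻¹).map_zero)).trans (Finsupp.single_zero _)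
      · refine Set.eq_empty_of_forall_notMem fun x hx => hγ ?_
        exact Finset.mem_image.2 ⟨a (δ • x), hΦ _, hx⟩
  have h2 : moveChain ha Φ n (Finsupp.single σ (rightMul f δ)) = ∑ γ ∈ Φ ∪ Φδ,
      Finsupp.single (γ • σ) (rightMul (restrictTo (ha γ) (rightMul f δ)) γ⁻¹) := by
    rw [moveChain_single, Finset.sum_subset (Finset.subset_union_left (s₂ := Φδ))]
    intro γ _ hγ
    rw [restrictTo_eq_zero]
    · exact (congrArg _ ((rightMulHom γ⁻¹).map_zero)).trans (Finsupp.single_zero _)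
    · exact Set.eq_empty_of_forall_notMem fun x hx => hγ (hx ▸ hΦ x)
  rw [map_sub, h1, h2, ← Finset.sum_sub_distrib]
  refine (freeNorm_sum_le _ _).trans (le_trans (le_of_eq ?_) (hC b a hb ha (Φ ∪ Φδ) fun x =>
    Finset.mem_union_right _ (Finset.mem_image_of_mem _ (hΦ _))))
  refine Finset.sum_congr rfl fun γ _ => ?_
  rw [← Finsupp.single_sub, freeNorm_single]
  exact (congrArg norm1 ((rightMulHom γ⁻¹).map_sub _ _)).symm.trans (norm1_rightMul μ _ γ⁻¹)

end Move

/-! ### Passing to coinvariants -/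

variable (μ Γ) in
/-- The projection `f ⊗ σ ↦ f ⊗ σ` to the parametrised chain group. -/
def toParamChain (n : ℕ) : FreeChain μ E n →+ ParamChain μ Γ E n :=
  Finsupp.liftAddHom fun σ => AddMonoidHom.mk' (fun f => elem μ Γ f σ) fun f g => elem_add μ f g σ

theorem toParamChain_single {n : ℕ} (σ : Simp E n) (f : LInftyZ μ) :
    toParamChain μ Γ n (Finsupp.single σ f) = elem μ Γ f σ :=
  Finsupp.liftAddHom_apply_single _ _ _

theorem toParamChain_apply {n : ℕ} (w : FreeChain μ E n) :
    toParamChain μ Γ n w = ∑ σ ∈ w.support, elem μ Γ (w σ) σ := by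
  conv_lhs => rw [← Finsupp.sum_single w, Finsupp.sum, map_sum]
  exact Finset.sum_congr rfl fun σ _ => toParamChain_single σ _

theorem toParamChain_surjective (n : ℕ) :
    Function.Surjective (toParamChain μ Γ (E := E) n) := by
  intro c
  obtain ⟨s, f, -, rfl⟩ := exists_isReducedForm μ c
  exact ⟨∑ σ ∈ s, Finsupp.single σ (f σ), by simp only [map_sum, toParamChain_single]⟩

theorem paramBoundary_toParamChain (n : ℕ) (w : FreeChain μ E (n + 1)) :
    paramBoundary μ Γ E n (toParamChain μ Γ (n + 1) w) = toParamChain μ Γ n (freeBoundary n w) := by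
  induction w using Finsupp.induction_linear with
  | zero => simp
  | add x y hx hy => simp only [map_add, hx, hy]
  | single σ f =>
    rw [toParamChain_single, paramBoundary_elem, freeBoundary_single, map_sum]
    exact Finset.sum_congr rfl fun i _ => by rw [map_zsmul, toParamChain_single]

theorem toParamChain_moveChain {a : X → Γ} (ha : ∀ γ, MeasurableSet {x | a x = γ}) {Φ : Finset Γ}
    (hΦ : ∀ x, a x ∈ Φ) {n : ℕ} (w : FreeChain μ E n) :
    toParamChain μ Γ n (moveChain ha Φ n w) = toParamChain μ Γ n w := by
  induction w using Finsupp.induction_linear with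
  | zero => simp
  | add x y hx hy => simp only [map_add, hx, hy]
  | single σ f =>
    rw [moveChain_single, map_sum]
    simp only [toParamChain_single, elem_smul, rightMul_rightMul, inv_mul_cancel, rightMul_one]
    conv_rhs => rw [← sum_restrictTo_fiber ha hΦ f, ← toParamChain_single]
    rw [Finsupp.single_finsetSum, map_sum]
    simp only [toParamChain_single]

/-- A translate of every singular simplex lies in a system of representatives of the orbits. -/
theorem exists_orbit_representatives (Γ E : Type*) [Group Γ] [TopologicalSpace E] [MulAction Γ E]
    [ContinuousConstSMul Γ E] (n : ℕ) : ∃ (ρ : Simp E n → Simp E n) (κ : Simp E n → Γ),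
      (∀ σ, κ σ • ρ σ = σ) ∧ ∀ σ τ, τ ∈ MulAction.orbit Γ (ρ σ) → ρ τ = ρ σ := by
  let ρ : Simp E n → Simp E n := fun σ => Quotient.out (s := MulAction.orbitRel Γ (Simp E n)) ⟦σ⟧
  have hρ : ∀ σ : Simp E n, ∃ γ : Γ, γ • ρ σ = σ := fun σ =>
    MulAction.orbitRel_apply.1 ((MulAction.orbitRel Γ (Simp E n)).symm
      (Quotient.mk_out (s := MulAction.orbitRel Γ (Simp E n)) σ))
  choose κ hκ using hρ
  refine ⟨ρ, κ, hκ, fun σ τ h => congrArg Quotient.out (Quotient.sound ?_)⟩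
  obtain ⟨γ, rfl⟩ := h
  refine MulAction.orbitRel_apply.2 ⟨γ * (κ σ)⁻¹, ?_⟩
  change (γ * (κ σ)⁻¹) • σ = γ • ρ σ
  rw [mul_smul, inv_smul_eq_iff.2 (hκ σ).symm]

/-- A lift of a parametrised chain attains the norm of this chain after all of its simplices have
been replaced by representatives of their orbits. -/
theorem exists_reduction [IsFiniteMeasure μ] (n : ℕ)
    (hfree : ∀ (γ : Γ) (σ : Simp E n), γ • σ = σ → γ = 1) :
    ∃ (ρ : Simp E n → Simp E n) (κ : Simp E n → Γ) (red : FreeChain μ E n →+ FreeChain μ E n),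
      (∀ σ, κ σ • ρ σ = σ) ∧
      (∀ σ f, red (Finsupp.single σ f) = Finsupp.single (ρ σ) (rightMul f (κ σ))) ∧
      (∀ w, freeNorm (red w) = l1Norm μ (toParamChain μ Γ n w)) ∧
      ∀ w, freeNorm (red w) ≤ freeNorm w := by
  obtain ⟨ρ, κ, hκ, hρ⟩ := exists_orbit_representatives Γ E n
  let red : FreeChain μ E n →+ FreeChain μ E n := Finsupp.liftAddHom fun σ =>
    (Finsupp.singleAddHom (ρ σ)).comp (rightMulHom (κ σ))
  have hred : ∀ σ f, red (Finsupp.single σ f) = Finsupp.single (ρ σ) (rightMul f (κ σ)) :=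
    fun σ f => Finsupp.liftAddHom_apply_single _ _ _
  have hP : ∀ w, toParamChain μ Γ n (red w) = toParamChain μ Γ n w := by
    intro w
    induction w using Finsupp.induction_linear with
    | zero => simp
    | add x y hx hy => simp only [map_add, hx, hy]
    | single σ f =>
      rw [hred, toParamChain_single, toParamChain_single, ← elem_smul, hκ]
  have hsupp : ∀ w, ∀ τ ∈ (red w).support, ∃ σ, τ = ρ σ := by
    classical
    intro w
    induction w using Finsupp.induction_linear with
    | zero => simp
    | add x y hx hy =>
      intro τ hτ
      rw [map_add] at hτ
      exact (Finset.mem_union.1 (Finsupp.support_add hτ)).elim (hx τ) (hy τ)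
    | single σ f =>
      intro τ hτ
      rw [hred] at hτ
      exact ⟨σ, Finset.mem_singleton.1 (Finsupp.support_single_subset hτ)⟩
  have hρρ : ∀ σ, ρ (ρ σ) = ρ σ := fun σ => hρ σ _ (MulAction.mem_orbit_self _)
  refine ⟨ρ, κ, red, hκ, hred, fun w => ?_, fun w => ?_⟩
  · refine (l1Norm_eq μ hfree (s := (red w).support) (f := red w) ⟨?_, ?_⟩).symm
    · intro σ hσ τ hτ h
      obtain ⟨σ, rfl⟩ := hsupp w σ hσ
      obtain ⟨τ, rfl⟩ := hsupp w τ hτ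
      rw [← hρ σ _ h, hρρ]
    · rw [← hP, toParamChain_apply]
  · refine freeNorm_map_le _ (fun σ f => ?_) w
    rw [hred, freeNorm_single, norm1_rightMul]

theorem l1Norm_toParamChain_le [IsFiniteMeasure μ] {n : ℕ}
    (hfree : ∀ (γ : Γ) (σ : Simp E n), γ • σ = σ → γ = 1) (w : FreeChain μ E n) :
    l1Norm μ (toParamChain μ Γ n w) ≤ freeNorm w := by
  obtain ⟨-, -, red, -, -, h1, h2⟩ := exists_reduction (μ := μ) n hfree
  rw [← h1]
  exact h2 w

theorem l1Norm_nonneg [IsFiniteMeasure μ] {n : ℕ} (c : ParamChain μ Γ E n) : 0 ≤ l1Norm μ c := by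
  refine Real.sInf_nonneg ?_
  rintro _ ⟨s, f, -, rfl⟩
  exact Finset.sum_nonneg fun σ _ => norm1_nonneg _

theorem eq_zero_of_l1Norm_eq_zero [IsFiniteMeasure μ] {n : ℕ}
    (hfree : ∀ (γ : Γ) (σ : Simp E n), γ • σ = σ → γ = 1) {c : ParamChain μ Γ E n}
    (hc : l1Norm μ c = 0) : c = 0 := by
  obtain ⟨s, f, h⟩ := exists_isReducedForm μ c
  rw [l1Norm_eq μ hfree h, Finset.sum_eq_zero_iff_of_nonneg fun σ _ => norm1_nonneg _] at hc
  rw [h.2]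
  refine Finset.sum_eq_zero fun σ hσ => ?_
  rw [eq_zero_of_norm1_eq_zero (hc σ hσ), ← toParamChain_single, Finsupp.single_zero, map_zero]

/-- If `a` is sufficiently close to being equivariant, moving a chain along `a` reduces its norm
to almost the norm of the parametrised chain that it represents. -/
theorem exists_freeNorm_moveChain_le [IsFiniteMeasure μ] {n : ℕ}
    (hfree : ∀ (γ : Γ) (σ : Simp E n), γ • σ = σ → γ = 1) (w : FreeChain μ E n) {ε : ℝ}
    (hε : 0 < ε) : ∃ (S : Finset Γ) (η : ℝ), 0 < η ∧
      ∀ (a : X → Γ) (ha : ∀ γ, MeasurableSet {x | a x = γ}) (Φ : Finset Γ), (∀ x, a x ∈ Φ) →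
      (∀ δ ∈ S, μ.real {x | a (δ • x) * δ ≠ a x} ≤ η) →
      freeNorm (moveChain ha Φ n w) ≤ l1Norm μ (toParamChain μ Γ n w) + ε := by
  classical
  obtain ⟨ρ, κ, red, hκ, hred, hnorm, -⟩ := exists_reduction (μ := μ) n hfree
  choose C hC0 hC using fun σ : Simp E n =>
    exists_freeNorm_moveChain_sub_le (κ σ) (ρ σ) (w σ)
  have hD : 0 ≤ ∑ σ ∈ w.support, C σ := Finset.sum_nonneg fun σ _ => hC0 σ
  have hη : 0 < ε / (∑ σ ∈ w.support, C σ + 1) := by positivity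
  refine ⟨w.support.image κ, _, hη, fun a ha Φ hΦ hS => ?_⟩
  have hdiff : w - red w = ∑ σ ∈ w.support, (Finsupp.single (κ σ • ρ σ) (w σ) -
      Finsupp.single (ρ σ) (rightMul (w σ) (κ σ))) := by
    conv_lhs => rw [← Finsupp.sum_single w, Finsupp.sum, map_sum, ← Finset.sum_sub_distrib]
    exact Finset.sum_congr rfl fun σ _ => by rw [hred, hκ]
  have h1 : freeNorm (moveChain ha Φ n (w - red w)) ≤ ε := by
    rw [hdiff, map_sum]
    calc _ ≤ ∑ σ ∈ w.support, C σ * (ε / (∑ σ ∈ w.support, C σ + 1)) :=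
          (freeNorm_sum_le _ _).trans (Finset.sum_le_sum fun σ hσ => (hC σ a ha Φ hΦ).trans
            (mul_le_mul_of_nonneg_left (hS _ (Finset.mem_image_of_mem _ hσ)) (hC0 σ)))
      _ ≤ ε := by
          rw [← Finset.sum_mul, mul_div_assoc', div_le_iff₀ (by linarith)]
          nlinarith
  have h2 : moveChain ha Φ n w = moveChain ha Φ n (red w) + moveChain ha Φ n (w - red w) := by
    rw [← map_add, add_sub_cancel]
  rw [h2, ← hnorm]
  exact (freeNorm_add_le _ _).trans (add_le_add (freeNorm_moveChain_le ha _) h1)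

end FreeChain

end ParamUBC

end

theorem theorem1p3 (d : ℕ) (hd : 0 < d)
    -- the universal covering of the torus and the group of deck transformations
    {Γ : Type*} [Group Γ] {E : Type*} [TopologicalSpace E] [MulAction Γ E]
    [ContinuousConstSMul Γ E] (p : E → (Fin d → Circle))
    (hp : ParamUBC.IsUniversalCovering Γ p)
    -- the essentially free standard `Γ`-space
    {X : Type*} [MeasurableSpace X] [StandardBorelSpace X] (μ : Measure X) [IsProbabilityMeasure μ]
    [MulAction Γ X] [MeasurableConstSMul Γ X] [SMulInvariantMeasure Γ X μ]
    (hfree : ∀ᵐ x ∂μ, ∀ γ : Γ, γ • x = x → γ = 1) :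
    ∀ n : ℕ, ParamUBC.UBC (C := ParamUBC.ParamChain μ Γ E)
      (ParamUBC.paramBoundary μ Γ E) (fun _ c => ParamUBC.l1Norm μ c) n := by
  open ParamUBC in
  intro n
  have hfr : ∀ {k : ℕ} (γ : Γ) (σ : Simp E k), γ • σ = σ → γ = 1 := fun γ σ h => hp.free γ σ h
  refine ⟨2, two_pos, ?_⟩
  rintro _ ⟨b₀, rfl⟩
  obtain ⟨w, rfl⟩ := toParamChain_surjective (n + 1) b₀
  rw [paramBoundary_toParamChain]
  rcases (l1Norm_nonneg (toParamChain μ Γ n (freeBoundary n w))).eq_or_lt with h0 | hpos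
  · have hz := l1Norm_toParamChain_le (μ := μ) (Γ := Γ) (n := n + 1) hfr
      (0 : FreeChain μ E (n + 1))
    refine ⟨0, by rw [map_zero, eq_zero_of_l1Norm_eq_zero hfr h0.symm], ?_⟩
    change l1Norm μ (0 : ParamChain μ Γ E (n + 1)) ≤ 2 * l1Norm μ _
    rw [← h0, mul_zero]
    simpa [freeNorm] using hz
  obtain ⟨ψ, hψ, hinj⟩ := hp.exists_injective_hom
  obtain ⟨h, -⟩ := hp.exists_homeomorph
  -- the norm of the boundary itself is an admissible error, as it does not vanish
  obtain ⟨S, η, hη, hS⟩ := exists_freeNorm_moveChain_le hfr (freeBoundary n w) hpos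
  obtain ⟨a, ha, hfin, haS⟩ := exists_almost_equivariant hψ hinj μ hfree S hη
  have hΦ : ∀ x, a x ∈ hfin.toFinset := fun x => by simp
  refine ⟨toParamChain μ Γ (n + 1)
    (coneChain h n (freeBoundary n (moveChain ha hfin.toFinset (n + 1) w))), ?_, ?_⟩
  · rw [paramBoundary_toParamChain, freeBoundary_coneChain_freeBoundary, freeBoundary_moveChain,
      toParamChain_moveChain ha hΦ]
  · refine (l1Norm_toParamChain_le hfr _).trans ((freeNorm_coneChain_le h _).trans ?_)
    rw [freeBoundary_moveChain, two_mul]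
    exact hS a ha _ hΦ haS
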